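/- Consider $M\ge 1$ stations $1,\dots,M$, each with two infinite buffers, one for red and one for green messages. Time is slotted, $t=1,2,\dots$. Let $R_i^t$ and $G_i^t$ be the numbers of red and green messages in the buffers of station $i$ at the beginning of slot $t$. In slot $t$ the following happens. - Station $i(t)=((t-1)\bmod M)+1$ attempts to transmit a red message if $R_{i(t)}^t>0$; no other station transmits red messages. - Every station $i$ with $G_i^t>0$ attempts to transmit a green message with probability $p\in[0,1]$, independently of everything else (also if it transmits a red message in the same slot). - The red transmission of station $i(t)$ succeeds if and only if this station does not attempt a green transmission in slot $t$. A green transmission of station $i$ succeeds if and only if no other station attempts a green transmission in slot $t$ and station $i$ does not attempt a red transmission in slot $t$. Successfully transmitted messages leave the system; the others stay in their buffers. - The numbers of new red and of new green messages arriving in the slots form two independent i.i.d. sequences of $\{0,1,2,\dots\}$-valued random variables with finite means $\lambda_R$ and $\lambda_G$, and each arriving message is assigned to a station chosen uniformly at random, independently of everything else. The new messages are added to the buffers at the end of the slot. The state of the system is the Markov chain $(i(t),R_1^t,\dots,R_M^t,G_1^t,\dots,G_M^t)$. A set $V$ of states is called positive recurrent if from every initial state the return time $\tau_V=\min\{n\ge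 1:\text{the chain is in }V\text{ after }n\text{ steps}\}$ is almost surely finite and $\sup_{x\in V}\mathbf E_x\tau_V<\infty$. The system is called stable if this Markov chain is positive recurrent, i.e. there is a state accessible from every state, and for every such state $z$ the set $\{z\}$ is positive recurrent. Theorem. If $\lambda_R<1-p$ and $$\begin{cases}\lambda_G<\left(1-\frac{\lambda_R}{1-p}\right)p,&\text{if } M=1,\\[1mm] \lambda_G<\frac{\lambda_R}{1-p}(M-1)p(1-p)^{M-1}+\left(1-\frac{\lambda_R}{1-p}\right)Mp(1-p)^{M-1},&\text{if } M>1,\end{cases}$$ then the system is stable. -/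

import Mathlib

open MeasureTheory ProbabilityTheory
open scoped NNReal ENNReal

namespace MultiAccess

/-! ## Markov chains on a discrete state space -/

section Chain

variable {S : Type*} [MeasurableSpace S] [DiscreteMeasurableSpace S]

/-- The transition kernel of the homogeneous Markov chain which moves from `x` to a state with
law `P x`. -/
noncomputable def chainKernel (P : S → PMF S) : Kernel S S where
  toFun x := (P x).toMeasure
  measurable' := Measurable.of_discrete

instance (P : S → PMF S) : IsMarkovKernel (chainKernel P) :=
  ⟨fun x => inferInstanceAs (IsProbabilityMeasure (P x).toMeasure)⟩

/-- The law of the next state given the whole past up to time `n`: it depends on the state at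
time `n` only. -/
noncomputable def historyKernel (P : S → PMF S) (n : ℕ) :
    Kernel ((_i : Finset.Iic n) → S) S :=
  (chainKernel P).comap (fun h => h ⟨n, Finset.mem_Iic.2 le_rfl⟩) (measurable_pi_apply _)

instance (P : S → PMF S) (n : ℕ) : IsMarkovKernel (historyKernel P n) := by
  unfold historyKernel; infer_instance

/-- The law, on the space of trajectories, of the Markov chain with transition probabilities `P`
started at `x` at time `0`. -/
noncomputable def pathLaw (P : S → PMF S) (x : S) : Measure (ℕ → S) :=
  Kernel.traj (X := fun _ => S) (historyKernel P) 0 (fun _ => x)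

/-- The return time `min {n ≥ 1 : ω n ∈ V}` of a trajectory to `V`, infinite if there is no
such `n`. -/
noncomputable def returnTime (V : Set S) (ω : ℕ → S) : ℝ≥0∞ :=
  ⨅ (n : ℕ) (_ : 1 ≤ n) (_ : ω n ∈ V), (n : ℝ≥0∞)

/-- The set `V` is positive recurrent: it is reached almost surely from every initial state, and
the mean return times to `V` of the states of `V` are bounded. -/
def IsPositiveRecurrentSet (P : S → PMF S) (V : Set S) : Prop :=
  (∀ x, ∀ᵐ ω ∂(pathLaw P x), returnTime V ω < ∞) ∧
    ⨆ x ∈ V, ∫⁻ ω, returnTime V ω ∂(pathLaw P x) < ∞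

/-- The state `y` is accessible from the state `x`. -/
def Accessible (P : S → PMF S) (x y : S) : Prop :=
  ∃ n : ℕ, 0 < pathLaw P x {ω | ω n = y}

/-- Positive recurrence of a Markov chain on a countable state space: some state is accessible
from all states, and every such state is positive recurrent. For an irreducible chain this says
that every state is positive recurrent. -/
def IsPositiveRecurrentChain (P : S → PMF S) : Prop :=
  (∃ z, ∀ x, Accessible P x z) ∧
    ∀ z, (∀ x, Accessible P x z) → IsPositiveRecurrentSet P {z}

end Chain

/-! ## The network without a MAC-coordinator -/

/-- The state of the network with `M` stations at the beginning of a time slot: the station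
scheduled for red transmission in this slot, and the lengths of all red and green queues. -/
@[ext]
structure State (M : ℕ) where
  scheduled : Fin M
  red : Fin M → ℕ
  green : Fin M → ℕ

instance (M : ℕ) : MeasurableSpace (State M) := ⊤

instance (M : ℕ) : DiscreteMeasurableSpace (State M) := ⟨fun _ => trivial⟩

namespace State

variable {M : ℕ}

/-- Station `i` attempts a green transmission, where `α i` is its random decision. -/
def GreenAttempt (s : State M) (α : Fin M → Bool) (i : Fin M) : Prop :=
  0 < s.green i ∧ α i = true

/-- Station `i` attempts a red transmission. -/
def RedAttempt (s : State M) (i : Fin M) : Prop :=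
  i = s.scheduled ∧ 0 < s.red i

/-- A red transmission fails if and only if it collides with a green transmission of the same
station. -/
def RedSuccess (s : State M) (α : Fin M → Bool) (i : Fin M) : Prop :=
  s.RedAttempt i ∧ ¬ s.GreenAttempt α i

/-- A green transmission is successful if and only if it is the only green transmission in the
slot and does not collide with a red transmission of the same station. -/
def GreenSuccess (s : State M) (α : Fin M → Bool) (i : Fin M) : Prop :=
  s.GreenAttempt α i ∧ (∀ j, j ≠ i → ¬ s.GreenAttempt α j) ∧ ¬ s.RedAttempt i

open Classical in
/-- The state at the beginning of the next slot, if `a i` red and `b i` green messages arrive at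
station `i` during the slot. The stations are scheduled cyclically. -/
noncomputable def next [NeZero M] (s : State M) (a b : Fin M → ℕ) (α : Fin M → Bool) :
    State M where
  scheduled := s.scheduled + 1
  red i := s.red i - (if s.RedSuccess α i then 1 else 0) + a i
  green i := s.green i - (if s.GreenSuccess α i then 1 else 0) + b i

end State

/-- The numbers of messages assigned to the `M` stations, if the total number of messages has law
`arrivals` and every message is assigned to a station uniformly at random, independently of the
others. -/
noncomputable def assign (M : ℕ) [NeZero M] (arrivals : PMF ℕ) : PMF (Fin M → ℕ) :=
  arrivals.bind fun n =>
    (PMF.uniformOfFintype (Fin n → Fin M)).map fun f i => (Finset.univ.filter (f · = i)).card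

/-- Independent decisions of the `M` stations, each one being `true` with probability `p`. -/
noncomputable def decisions (M : ℕ) (p : ℝ≥0) (hp : p ≤ 1) : PMF (Fin M → Bool) :=
  PMF.ofFintype (fun α => ∏ i, if α i then (p : ℝ≥0∞) else 1 - (p : ℝ≥0∞)) <| by
    rw [← Fintype.prod_sum (fun (_ : Fin M) (b : Bool) => if b then (p : ℝ≥0∞) else 1 - p)]
    have : (p : ℝ≥0∞) + (1 - p) = 1 := add_tsub_cancel_of_le (by exact_mod_cast hp)
    simp [this]

/-- The transition probabilities of the network with `M` stations, green transmission probability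
`p`, and laws `redLaw` and `greenLaw` of the total numbers of red and green messages which arrive
in a slot. Red arrivals, green arrivals and decisions are independent of each other and of the
current state. -/
noncomputable def transition (M : ℕ) [NeZero M] (p : ℝ≥0) (hp : p ≤ 1) (redLaw greenLaw : PMF ℕ)
    (s : State M) : PMF (State M) :=
  (assign M redLaw).bind fun a => (assign M greenLaw).bind fun b =>
    (decisions M p hp).map fun α => s.next a b α

/-- The law `q` of a number of messages has the finite mean `l`. -/
def HasMean (q : PMF ℕ) (l : ℝ) : Prop :=
  HasSum (fun n => (q n).toReal * n) l

/-- The network is stable if its Markov chain is positive recurrent. -/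
def Stable (M : ℕ) [NeZero M] (p : ℝ≥0) (hp : p ≤ 1) (redLaw greenLaw : PMF ℕ) : Prop :=
  IsPositiveRecurrentChain (transition M p hp redLaw greenLaw)

end MultiAccess

/-! Write `c = p(1-p)^(M-1)`, `a = lR/M`, `g = lG/M`. For every `M`, the rate condition says `g + κa
< c` with `κ = c/(1-p)`. Here `c` is the chance that station `i` alone decides to send green, a
lower bound for its green service in any state where it has green and attempts no red. A red attempt
succeeds with probability at least `1-p`, so it lowers `κR_i` by at least `c` on average. Hence `W_i
= G_i + κR_i` has negative drift whenever `G_i > 0`, whether or not the station attempts red.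

If `G_i = 0`, then `W_i = κR_i` may grow, but this is paid for by the red queue. Red is served only
once per cycle, so `R_i` is corrected by `θ` times the waiting time until the next turn. With `θ =
(1-p)/M`, the corrected queue `T_i` has negative drift in every slot unless it is zero. Weighting
`T_i` by a large `γ`, the linear part of the drift of the sum of squares of all loads `W_i`, `γT_i`
is at most a negative multiple of the sum of the loads (`station_drift_le`).

Arrivals have only first moments, so the sum of squares need not have a finite mean. The Lyapunov
function is therefore its square root, made smooth at the origin: batches of bounded size are
expanded to second order, larger ones enter through a Lipschitz bound with small mean
(`smoothNorm_load_next_le`). This gives drift at most `-ε/4` outside a finite set.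

Foster's criterion (`isPositiveRecurrentSet_singleton_of_drift`) then applies to every state
accessible from everywhere. The empty state is one of these, because slots without arrivals have
positive probability (`reaches_empty`). -/

namespace MultiAccess

/-! ### Expectations under discrete laws. -/

section Mean

/-- Expectation of an extended nonnegative function of a discrete random variable. -/
noncomputable def pmfMean {A : Type*} (q : PMF A) (φ : A → ℝ≥0∞) : ℝ≥0∞ := ∑' y, q y * φ y

lemma pmfMean_mono {A : Type*} (q : PMF A) {φ ψ : A → ℝ≥0∞} (h : ∀ y, φ y ≤ ψ y) :
    pmfMean q φ ≤ pmfMean q ψ :=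
  ENNReal.tsum_le_tsum fun y => mul_le_mul_right (h y) _

lemma pmfMean_add {A : Type*} (q : PMF A) (φ ψ : A → ℝ≥0∞) :
    pmfMean q (fun y => φ y + ψ y) = pmfMean q φ + pmfMean q ψ := by
  simp only [pmfMean, mul_add, ENNReal.tsum_add]

lemma pmfMean_const_mul {A : Type*} (q : PMF A) (c : ℝ≥0∞) (φ : A → ℝ≥0∞) :
    pmfMean q (fun y => c * φ y) = c * pmfMean q φ := by
  simp only [pmfMean, ← ENNReal.tsum_mul_left]
  exact tsum_congr fun y => by ring

lemma pmfMean_const {A : Type*} (q : PMF A) (c : ℝ≥0∞) : pmfMean q (fun _ => c) = c := by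
  simp [pmfMean, ENNReal.tsum_mul_right, q.tsum_coe]

lemma pmfMean_sum {A ι : Type*} (q : PMF A) (s : Finset ι) (φ : ι → A → ℝ≥0∞) :
    pmfMean q (fun y => ∑ i ∈ s, φ i y) = ∑ i ∈ s, pmfMean q (φ i) := by
  classical
  induction s using Finset.induction_on with
  | empty => simp [pmfMean]
  | insert i s hi ih => simp only [Finset.sum_insert hi, pmfMean_add, ih]

lemma pmfMean_pure {A : Type*} (a : A) (φ : A → ℝ≥0∞) : pmfMean (PMF.pure a) φ = φ a := by
  rw [pmfMean, tsum_eq_single a]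
  · simp
  · intro b hb; simp [hb]

lemma pmfMean_bind {A B : Type*} (q : PMF A) (r : A → PMF B) (φ : B → ℝ≥0∞) :
    pmfMean (q.bind r) φ = pmfMean q fun a => pmfMean (r a) φ := by
  simp only [pmfMean, PMF.bind_apply, ← ENNReal.tsum_mul_right, ← ENNReal.tsum_mul_left]
  rw [ENNReal.tsum_comm]
  exact tsum_congr fun a => tsum_congr fun b => by ring

lemma pmfMean_map {A B : Type*} (q : PMF A) (r : A → B) (φ : B → ℝ≥0∞) :
    pmfMean (q.map r) φ = pmfMean q fun a => φ (r a) := by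
  rw [← PMF.bind_pure_comp, pmfMean_bind]
  simp [pmfMean_pure]

end Mean

/-! ### The killed operator and return times. -/

/-- The operator of the chain killed upon entering `V`. -/
noncomputable def killedStep {S : Type*} (P : S → PMF S) (V : Set S) (φ : S → ℝ≥0∞) (x : S) : ℝ≥0∞ :=
  pmfMean (P x) (Vᶜ.indicator φ)

section Killed

variable {S : Type*} (P : S → PMF S) (V : Set S)

lemma killedStep_mono {φ ψ : S → ℝ≥0∞} (h : φ ≤ ψ) : killedStep P V φ ≤ killedStep P V ψ :=
  fun _ => pmfMean_mono _ fun _ => Set.indicator_le_indicator (h _)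

lemma killedStep_le_pmfMean (φ : S → ℝ≥0∞) (x : S) : killedStep P V φ x ≤ pmfMean (P x) φ :=
  pmfMean_mono _ fun _ => Set.indicator_le_self _ _ _

lemma killedStep_add (φ ψ : S → ℝ≥0∞) :
    killedStep P V (φ + ψ) = killedStep P V φ + killedStep P V ψ := by
  ext x
  simp only [killedStep, Set.indicator_add', Pi.add_apply, ← pmfMean_add]
  rfl

lemma killedStep_const_mul (c : ℝ≥0∞) (φ : S → ℝ≥0∞) :
    killedStep P V (fun y => c * φ y) = fun x => c * killedStep P V φ x := by
  ext x
  simp only [killedStep, ← pmfMean_const_mul]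
  congr 1
  ext y
  by_cases h : y ∈ Vᶜ <;> simp [Set.indicator, h]

lemma killedStep_sum {ι : Type*} (s : Finset ι) (φ : ι → S → ℝ≥0∞) (x : S) :
    killedStep P V (fun y => ∑ i ∈ s, φ i y) x = ∑ i ∈ s, killedStep P V (φ i) x := by
  simp only [killedStep, ← pmfMean_sum]
  congr 1
  ext y
  by_cases h : y ∈ Vᶜ <;> simp [Set.indicator, h]

/-- The iterates of `1` are the probabilities of avoiding `V` at the times `1, …, n`. -/
lemma iterate_killedStep_one_antitone (x : S) :
    Antitone fun n => (killedStep P V)^[n] 1 x := by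
  refine antitone_nat_of_succ_le fun n => ?_
  have hle : killedStep P V 1 ≤ 1 := fun y =>
    (killedStep_le_pmfMean P V 1 y).trans (pmfMean_const (P y) 1).le
  have : ∀ n, (killedStep P V)^[n] (killedStep P V 1) ≤ (killedStep P V)^[n] 1 := by
    intro n
    induction n with
    | zero => exact hle
    | succ n ih =>
      simp only [Function.iterate_succ_apply'] at ih ⊢
      exact killedStep_mono P V ih
  exact this n x

/-- A supersolution of the Poisson equation dominates the mean return times. -/
lemma tsum_iterate_killedStep_le {v : S → ℝ≥0∞} (hv : ∀ x, killedStep P V v x + 1 ≤ v x) (x : S) :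
    ∑' n, (killedStep P V)^[n] 1 x ≤ v x := by
  -- The inequality `Kv + 1 ≤ v` is iterated; the remainder `K^n v` is dropped at the end.
  have h : ∀ n, (∑ k ∈ Finset.range n, (killedStep P V)^[k] 1) + (killedStep P V)^[n] v ≤ v := by
    intro n
    induction n with
    | zero => simp
    | succ n ih =>
      refine le_trans ?_ ih
      rw [Finset.sum_range_succ, add_assoc]
      refine add_le_add le_rfl ?_
      have : ∀ n, (killedStep P V)^[n] 1 + (killedStep P V)^[n] (killedStep P V v)
          ≤ (killedStep P V)^[n] v := by
        intro n
        induction n with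
        | zero => exact fun y => by simpa [add_comm] using hv y
        | succ n ih =>
          simp only [Function.iterate_succ_apply'] at ih ⊢
          rw [← killedStep_add]
          exact killedStep_mono P V ih
      exact this n
  refine ENNReal.tsum_le_of_sum_range_le fun n => ?_
  have := h n x
  simp only [Pi.add_apply, Finset.sum_apply] at this
  exact le_self_add.trans this

end Killed

/-- The trajectory does not visit `V` at the times `1, …, n`. -/
def avoids {S : Type*} (V : Set S) (n : ℕ) : Set (ℕ → S) := {ω | ∀ k, 1 ≤ k → k ≤ n → ω k ∉ V}

/-- A return time is the number of `n ≥ 0` which it exceeds. Time `0` is never tested, so a start in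
`V` does not count as a return. -/
lemma returnTime_le_tsum {S : Type*} (V : Set S) (ω : ℕ → S) :
    returnTime V ω ≤ ∑' n, (avoids V n).indicator (1 : (ℕ → S) → ℝ≥0∞) ω := by
  classical
  by_cases h : ∃ n, 1 ≤ n ∧ ω n ∈ V
  · have hN := Nat.find_spec h
    calc returnTime V ω ≤ (Nat.find h : ℝ≥0∞) :=
          (iInf_le _ _).trans ((iInf_le _ hN.1).trans (iInf_le _ hN.2))
      _ = ∑ n ∈ Finset.range (Nat.find h), (avoids V n).indicator (1 : (ℕ → S) → ℝ≥0∞) ω := by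
          rw [Finset.sum_congr rfl (g := fun _ => (1 : ℝ≥0∞))]
          · simp
          · intro n hn
            refine Set.indicator_of_mem (fun k h1 h2 hk => ?_) _
            exact Nat.find_min h (h2.trans_lt (Finset.mem_range.1 hn)) ⟨h1, hk⟩
      _ ≤ _ := ENNReal.sum_le_tsum _
  · push Not at h
    have : ∀ n, (avoids V n).indicator (1 : (ℕ → S) → ℝ≥0∞) ω = 1 := fun n =>
      Set.indicator_of_mem (show ω ∈ avoids V n from fun k h1 _ => h k h1) _
    simp [this]

/-! ### From the trajectory measure to iterates of the killed operator. -/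

section Markov

variable {S : Type*} [MeasurableSpace S] [DiscreteMeasurableSpace S]

instance (P : S → PMF S) (x : S) : IsProbabilityMeasure (pathLaw P x) := by
  unfold pathLaw; infer_instance

lemma lintegral_toMeasure_eq_pmfMean [Countable S] (q : PMF S) (φ : S → ℝ≥0∞) :
    ∫⁻ y, φ y ∂q.toMeasure = pmfMean q φ := by
  rw [lintegral_countable']
  refine tsum_congr fun y => ?_
  rw [PMF.toMeasure_apply_singleton _ _ (MeasurableSet.singleton y), mul_comm]

/-- The Markov property at time `n`. -/
lemma lintegral_pathLaw_succ [Countable S] (P : S → PMF S) (x : S) (n : ℕ)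
    {g : ((_i : Finset.Iic n) → S) → ℝ≥0∞} (hg : Measurable g) (φ : S → ℝ≥0∞) :
    ∫⁻ ω, g (Preorder.frestrictLe n ω) * φ (ω (n + 1)) ∂pathLaw P x
      = ∫⁻ ω, g (Preorder.frestrictLe n ω) * pmfMean (P (ω n)) φ ∂pathLaw P x := by
  have hφ : Measurable φ := Measurable.of_discrete
  have hmean : Measurable fun y => pmfMean (P y) φ := Measurable.of_discrete
  have hF : Measurable fun ω : ℕ → S => g (Preorder.frestrictLe n ω) * φ (ω (n + 1)) :=
    (hg.comp (Preorder.measurable_frestrictLe n)).mul (hφ.comp (measurable_pi_apply _))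
  have hmean' : Measurable fun h : ((_i : Finset.Iic n) → S) =>
      g h * pmfMean (P (h ⟨n, Finset.mem_Iic.2 le_rfl⟩)) φ :=
    hg.mul (hmean.comp (measurable_pi_apply _))
  have inner (h : (_i : Finset.Iic n) → S) :
      ∫⁻ ω, g (Preorder.frestrictLe n ω) * φ (ω (n + 1))
          ∂Kernel.traj (X := fun _ => S) (historyKernel P) n h
        = g h * pmfMean (P (h ⟨n, Finset.mem_Iic.2 le_rfl⟩)) φ := by
    rw [Kernel.lintegral_traj _ hF]
    -- Given the history `h`, the factor `g` is a constant and only the coordinate `n + 1` is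
    -- random.
    have hr (ω : ℕ → S) :
        g (Preorder.frestrictLe n (Function.updateFinset ω (Finset.Iic n) h))
          * φ (Function.updateFinset ω (Finset.Iic n) h (n + 1)) = g h * φ (ω (n + 1)) := by
      congr 2
      · ext i
        simp [Function.updateFinset, Preorder.frestrictLe]
      · simp [Function.updateFinset]
    simp_rw [hr]
    rw [lintegral_const_mul _ (f := fun ω : ℕ → S => φ (ω (n + 1)))
      (hφ.comp (measurable_pi_apply _))]
    congr 1
    have hmap := Kernel.map_traj_succ_self (X := fun _ => S) (κ := historyKernel P) (a := n)
    rw [← lintegral_map (f := φ) (g := fun ω : ℕ → S => ω (n + 1)) hφ (measurable_pi_apply _),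
      ← Kernel.map_apply _ (measurable_pi_apply _), hmap, ← lintegral_toMeasure_eq_pmfMean]
    rfl
  have hcomp := Kernel.traj_comp_partialTraj (X := fun _ => S) (κ := historyKernel P)
    (Nat.zero_le n)
  unfold pathLaw
  conv_lhs => rw [← hcomp]
  rw [Kernel.lintegral_comp _ _ _ hF]
  simp_rw [inner]
  rw [← Kernel.traj_map_frestrictLe_apply, lintegral_map hmean' (Preorder.measurable_frestrictLe n)]
  rfl

lemma measurableSet_avoids (V : Set S) (n : ℕ) : MeasurableSet (avoids V n) := by
  have : avoids V n = ⋂ k, ⋂ (_ : 1 ≤ k), ⋂ (_ : k ≤ n), (fun ω : ℕ → S => ω k) ⁻¹' Vᶜ := by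
    ext ω; simp [avoids]
  rw [this]
  exact .iInter fun k => .iInter fun _ => .iInter fun _ =>
    measurable_pi_apply k (MeasurableSet.of_discrete)

lemma lintegral_avoids [Countable S] (P : S → PMF S) (V : Set S) (x : S) (n : ℕ) (φ : S → ℝ≥0∞) :
    ∫⁻ ω, (avoids V n).indicator 1 ω * φ (ω n) ∂pathLaw P x = (killedStep P V)^[n] φ x := by
  induction n generalizing φ with
  | zero =>
    have h0 : ∀ ω : ℕ → S, (avoids V 0).indicator (1 : (ℕ → S) → ℝ≥0∞) ω = 1 := by
      intro ω
      exact Set.indicator_of_mem (fun k h1 h2 => by omega) _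
    have hm : Measurable fun ω : ℕ → S => φ (ω 0) :=
      (Measurable.of_discrete (f := φ)).comp (measurable_pi_apply 0)
    simp_rw [h0, one_mul]
    unfold pathLaw
    rw [Kernel.lintegral_traj _ hm]
    simp [Function.updateFinset]
  | succ n ih =>
    rw [Function.iterate_succ_apply, ← ih]
    -- Avoidance up to time `n` as an event of the history, the form required by the Markov
    -- property.
    let A : Set ((_i : Finset.Iic n) → S) :=
      {h | ∀ k (hk : k ≤ n), 1 ≤ k → h ⟨k, Finset.mem_Iic.2 hk⟩ ∉ V}
    have hA : MeasurableSet A := by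
      have : A = ⋂ k, ⋂ (hk : k ≤ n), ⋂ (_ : 1 ≤ k),
          (fun h : (_i : Finset.Iic n) → S => h ⟨k, Finset.mem_Iic.2 hk⟩) ⁻¹' Vᶜ := by
        ext ω; simp [A]
      rw [this]
      exact .iInter fun k => .iInter fun _ => .iInter fun _ =>
        measurable_pi_apply _ (MeasurableSet.of_discrete)
    have hAn (ω : ℕ → S) : A.indicator (1 : ((_i : Finset.Iic n) → S) → ℝ≥0∞) (Preorder.frestrictLe n ω)
        = (avoids V n).indicator 1 ω := by
      have : Preorder.frestrictLe n ω ∈ A ↔ ω ∈ avoids V n :=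
        ⟨fun h k h1 h2 => h k h2 h1, fun h k h1 h2 => h k h2 h1⟩
      by_cases h : ω ∈ avoids V n
      · rw [Set.indicator_of_mem (this.2 h), Set.indicator_of_mem h]; rfl
      · rw [Set.indicator_of_notMem (mt this.1 h), Set.indicator_of_notMem h]
    have key := lintegral_pathLaw_succ P x n (g := A.indicator 1)
      (measurable_one.indicator hA) (Vᶜ.indicator φ)
    simp_rw [hAn] at key
    unfold killedStep
    rw [← key]
    refine lintegral_congr fun ω => ?_
    have : ω ∈ avoids V (n + 1) ↔ ω ∈ avoids V n ∧ ω (n + 1) ∈ Vᶜ := by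
      constructor
      · exact fun h => ⟨fun k h1 h2 => h k h1 (by omega), h _ (by omega) le_rfl⟩
      · rintro ⟨h, h'⟩ k h1 h2
        rcases Nat.lt_or_ge n k with hk | hk
        · obtain rfl : k = n + 1 := by omega
          exact h'
        · exact h k h1 hk
    by_cases h1 : ω ∈ avoids V n <;> by_cases h2 : ω (n + 1) ∈ Vᶜ <;>
      simp [Set.indicator, this, h1, h2]

lemma lintegral_returnTime_le [Countable S] (P : S → PMF S) (V : Set S) (x : S) :
    ∫⁻ ω, returnTime V ω ∂pathLaw P x ≤ ∑' n, (killedStep P V)^[n] 1 x := by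
  calc _ ≤ ∫⁻ ω, ∑' n, (avoids V n).indicator (1 : (ℕ → S) → ℝ≥0∞) ω ∂pathLaw P x :=
        lintegral_mono (returnTime_le_tsum V)
    _ = ∑' n, ∫⁻ ω, (avoids V n).indicator (1 : (ℕ → S) → ℝ≥0∞) ω ∂pathLaw P x :=
        lintegral_tsum fun n => (measurable_one.indicator (measurableSet_avoids V n)).aemeasurable
    _ = _ := by
        refine tsum_congr fun n => ?_
        rw [← lintegral_avoids]
        simp

lemma measurable_returnTime (V : Set S) : Measurable (returnTime V) := by
  classical
  unfold returnTime
  refine Measurable.iInf fun n => Measurable.iInf fun _ => ?_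
  have : (fun ω : ℕ → S => ⨅ (_ : ω n ∈ V), (n : ℝ≥0∞))
      = fun ω => if ω n ∈ V then (n : ℝ≥0∞) else ∞ := by
    ext ω; by_cases h : ω n ∈ V <;> simp [h]
  rw [this]
  exact Measurable.ite (measurable_pi_apply n (MeasurableSet.of_discrete)) measurable_const
    measurable_const

lemma isPositiveRecurrentSet_singleton_of_supersolution [Countable S] (P : S → PMF S) (z : S)
    {v : S → ℝ≥0∞} (hfin : ∀ x, v x ≠ ∞) (hv : ∀ x, killedStep P {z} v x + 1 ≤ v x) :
    IsPositiveRecurrentSet P {z} := by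
  have hle (x : S) : ∫⁻ ω, returnTime {z} ω ∂pathLaw P x ≤ v x :=
    (lintegral_returnTime_le P {z} x).trans (tsum_iterate_killedStep_le P {z} hv x)
  refine ⟨fun x => ?_, ?_⟩
  · exact ae_lt_top (measurable_returnTime _) ((hle x).trans_lt (hfin x).lt_top).ne
  · simpa using (hle z).trans_lt (hfin z).lt_top

end Markov

/-! ### Reachability and the chance of avoiding a state. -/

/-- `y` can be reached from `x` in a finite number of transitions of positive probability. -/
def Reaches {S : Type*} (P : S → PMF S) : S → S → Prop :=
  Relation.ReflTransGen fun x y => P x y ≠ 0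

section Reach

variable {S : Type*} (P : S → PMF S)

lemma killedStep_ne_zero_iff (V : Set S) (φ : S → ℝ≥0∞) (x : S) :
    killedStep P V φ x ≠ 0 ↔ ∃ y, P x y ≠ 0 ∧ y ∉ V ∧ φ y ≠ 0 := by
  simp [killedStep, pmfMean, ENNReal.tsum_eq_zero, Set.indicator_apply_eq_zero]

lemma killedStep_lt_one {z : S} {φ : S → ℝ≥0∞} (hφ : φ ≤ 1) {x y : S} (hxy : P x y ≠ 0)
    (hy : y = z ∨ φ y < 1) : killedStep P {z} φ x < 1 := by
  have hle : ∀ w, P x w * ({z}ᶜ : Set S).indicator φ w ≤ P x w := fun w =>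
    mul_le_of_le_one_right' ((Set.indicator_le_self _ _ _).trans (hφ w))
  have hlt : ({z}ᶜ : Set S).indicator φ y < 1 := by
    by_cases h : y = z
    · simp [h]
    · rw [Set.indicator_of_mem (by simpa using h)]
      exact hy.resolve_left h
  calc killedStep P {z} φ x < ∑' w, P x w := by
        refine ENNReal.tsum_lt_tsum ?_ hle (i := y) ?_
        · refine ne_top_of_le_ne_top ENNReal.one_ne_top ?_
          exact (ENNReal.tsum_le_tsum hle).trans (P x).tsum_coe.le
        · calc P x y * ({z}ᶜ : Set S).indicator φ y < P x y * 1 :=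
                (ENNReal.mul_lt_mul_iff_right hxy ((P x).apply_ne_top y)).2 hlt
            _ = P x y := mul_one _
    _ = 1 := (P x).tsum_coe

lemma iterate_killedStep_one_le_one (V : Set S) (n : ℕ) (x : S) : (killedStep P V)^[n] 1 x ≤ 1 :=
  iterate_killedStep_one_antitone P V x (Nat.zero_le n)

lemma exists_iterate_killedStep_one_lt_one {z : S} (hz : ∀ x, Reaches P x z) (x : S) :
    ∃ n, (killedStep P {z})^[n] 1 x < 1 := by
  -- One transition is made before following the path to `z`: for `x = z` the path may be empty, but
  -- a return takes at least one step.
  have key : ∀ y, Reaches P y z → ∀ x, P x y ≠ 0 → ∃ n, (killedStep P {z})^[n] 1 x < 1 := by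
    intro y hy
    induction hy using Relation.ReflTransGen.head_induction_on with
    | refl => exact fun x hx => ⟨1, killedStep_lt_one P le_rfl hx (.inl rfl)⟩
    | head h _ ih =>
      intro x hx
      obtain ⟨n, hn⟩ := ih _ h
      refine ⟨n + 1, ?_⟩
      rw [Function.iterate_succ_apply']
      exact killedStep_lt_one P (iterate_killedStep_one_le_one P _ n) hx (.inr hn)
  obtain ⟨y, hy⟩ := (P x).support_nonempty
  exact key y (hz y) x ((PMF.mem_support_iff _ _).1 hy)

/-- Avoidance probabilities decrease in `n`, so the largest time and the smallest gap serve all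
points of `F`. -/
lemma exists_uniform_iterate_killedStep {z : S} (hz : ∀ x, Reaches P x z) {F : Set S}
    (hF : F.Finite) :
    ∃ n, ∃ δ : ℝ≥0∞, δ ≠ 0 ∧ ∀ x ∈ F, (killedStep P {z})^[n] 1 x + δ ≤ 1 := by
  induction F, hF using Set.Finite.induction_on with
  | empty => exact ⟨0, 1, one_ne_zero, by simp⟩
  | @insert a F _ _ ih =>
    obtain ⟨n, δ, hδ, h⟩ := ih
    obtain ⟨m, hm⟩ := exists_iterate_killedStep_one_lt_one P hz a
    refine ⟨max n m, min δ (1 - (killedStep P {z})^[m] 1 a), ?_, ?_⟩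
    · exact (lt_min (pos_iff_ne_zero.2 hδ) (tsub_pos_of_lt hm)).ne'
    · rintro x (rfl | hx)
      · calc _ ≤ (killedStep P {z})^[m] 1 x + (1 - (killedStep P {z})^[m] 1 x) :=
              add_le_add (iterate_killedStep_one_antitone P _ x (le_max_right _ _))
                (min_le_right _ _)
          _ = 1 := add_tsub_cancel_of_le hm.le
      · exact (add_le_add (iterate_killedStep_one_antitone P _ x (le_max_left _ _))
          (min_le_left _ _)).trans (h x hx)

end Reach

/-! ### Foster's criterion. -/

section Foster

variable {S : Type*} [MeasurableSpace S] [DiscreteMeasurableSpace S] [Countable S]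

lemma accessible_iff_reaches (P : S → PMF S) (x y : S) : Accessible P x y ↔ Reaches P x y := by
  classical
  -- Nothing is killed for `V = ∅`, so the iterates give the `n`-step probabilities.
  have hlaw (n : ℕ) (x : S) :
      pathLaw P x {ω | ω n = y} = (killedStep P ∅)^[n] (({y} : Set S).indicator 1) x := by
    rw [← lintegral_avoids, ← lintegral_indicator_one]
    · refine lintegral_congr fun ω => ?_
      simp [avoids, Set.indicator]
    · have hm : Measurable fun ω : ℕ → S => ω n := measurable_pi_apply n
      exact hm (MeasurableSet.of_discrete (s := {y}))
  simp only [Accessible, hlaw, pos_iff_ne_zero]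
  constructor
  · rintro ⟨n, hn⟩
    induction n generalizing x with
    | zero =>
      obtain rfl : x ∈ ({y} : Set S) := Set.mem_of_indicator_ne_zero hn
      exact .refl
    | succ n ih =>
      rw [Function.iterate_succ_apply', killedStep_ne_zero_iff] at hn
      obtain ⟨w, h1, -, h2⟩ := hn
      exact .head h1 (ih w h2)
  · intro h
    induction h using Relation.ReflTransGen.head_induction_on with
    | refl => exact ⟨0, by simp⟩
    | head h _ ih =>
      obtain ⟨n, hn⟩ := ih
      refine ⟨n + 1, ?_⟩
      rw [Function.iterate_succ_apply', killedStep_ne_zero_iff]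
      exact ⟨_, h, by simp, hn⟩

/-- **Foster's criterion**: a function with negative drift outside a finite set makes every state
which is accessible from everywhere positive recurrent. -/
theorem isPositiveRecurrentSet_singleton_of_drift (P : S → PMF S) {f : S → ℝ≥0∞} {F : Set S}
    {ε b : ℝ≥0∞} (hf : ∀ x, f x ≠ ∞) (hF : F.Finite) (hε : ε ≠ 0) (hε' : ε ≠ ∞) (hb : b ≠ ∞)
    (hdrift : ∀ x, pmfMean (P x) f + ε ≤ f x + F.indicator (fun _ => b) x) {z : S}
    (hz : ∀ x, Accessible P x z) : IsPositiveRecurrentSet P {z} := by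
  obtain ⟨N, δ, hδ, hN⟩ := exists_uniform_iterate_killedStep P
    (fun x => (accessible_iff_reaches P x z).1 (hz x)) hF
  set K := killedStep P {z} with hK
  -- Mean return time to `z` cut off at `N`. It satisfies `Kg = g - 1 + K^N 1`, so it never
  -- increases in the mean and drops by at least `δ` on `F`.
  let g : S → ℝ≥0∞ := fun x => ∑ k ∈ Finset.range N, K^[k] 1 x
  have hKg (x : S) : K g x + 1 = g x + K^[N] 1 x := by
    have h1 : K g x = ∑ k ∈ Finset.range N, K^[k + 1] 1 x := by
      simp only [g, hK, killedStep_sum, Function.iterate_succ_apply']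
    have h2 := Finset.sum_range_succ' (fun k => K^[k] (1 : S → ℝ≥0∞) x) N
    rw [Finset.sum_range_succ] at h2
    rw [h1]
    exact h2.symm
  have hH (x : S) : K^[N] 1 x ≤ 1 := iterate_killedStep_one_le_one P {z} N x
  have hHt (x : S) : K^[N] 1 x ≠ ∞ := ne_top_of_le_ne_top ENNReal.one_ne_top (hH x)
  have hg (x : S) : g x ≠ ∞ := by
    refine ENNReal.sum_ne_top.2 fun k _ => ?_
    exact ne_top_of_le_ne_top ENNReal.one_ne_top (iterate_killedStep_one_le_one P {z} k x)
  have hdec (x : S) : K g x + F.indicator (fun _ => δ) x ≤ g x := by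
    refine (ENNReal.add_le_add_iff_right (hHt x)).1 ?_
    rw [← hKg, add_assoc]
    refine add_le_add le_rfl ?_
    by_cases hx : x ∈ F
    · rw [Set.indicator_of_mem hx, add_comm]
      exact hN x hx
    · rw [Set.indicator_of_notMem hx, zero_add]
      exact hH x
  have hδt : b / δ ≠ ∞ := ENNReal.div_ne_top hb hδ
  -- The factor `b / δ` makes the drop of `g` on `F` pay for the excess `b` of the drift of `f`;
  -- `ε⁻¹` normalizes the total decrease to `1`.
  let v : S → ℝ≥0∞ := fun x => ε⁻¹ * (f x + (b / δ) * g x)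
  refine isPositiveRecurrentSet_singleton_of_supersolution P z (v := v) (fun x => ?_) fun x => ?_
  · exact ENNReal.mul_ne_top (ENNReal.inv_ne_top.2 hε)
      (ENNReal.add_ne_top.2 ⟨hf x, ENNReal.mul_ne_top hδt (hg x)⟩)
  · have hv : K v x = ε⁻¹ * (K f x + (b / δ) * K g x) := by
      have h1 : K v = fun x => ε⁻¹ * K (f + fun x => (b / δ) * g x) x :=
        killedStep_const_mul P {z} ε⁻¹ _
      rw [h1, hK, killedStep_add, killedStep_const_mul]
      rfl
    have hb' (hx : x ∈ F) : b ≤ b / δ * δ := by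
      by_cases hδ' : δ = ∞
      · have := hN x hx
        simp [hδ'] at this
      · rw [ENNReal.div_mul_cancel hδ hδ']
    rw [← hK, hv]
    calc ε⁻¹ * (K f x + b / δ * K g x) + 1
        = ε⁻¹ * ((K f x + ε) + b / δ * K g x) := by
          rw [← ENNReal.inv_mul_cancel hε hε', ← mul_add]
          ring_nf
      _ ≤ ε⁻¹ * ((f x + F.indicator (fun _ => b) x) + b / δ * K g x) := by
          gcongr ε⁻¹ * (?_ + b / δ * K g x)
          exact (add_le_add (killedStep_le_pmfMean P {z} f x) le_rfl).trans (hdrift x)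
      _ ≤ ε⁻¹ * (f x + b / δ * (K g x + F.indicator (fun _ => δ) x)) := by
          rw [mul_add (b / δ), add_assoc, add_comm (b / δ * K g x)]
          gcongr
          by_cases hx : x ∈ F
          · simpa [hx] using hb' hx
          · simp [hx]
      _ ≤ ε⁻¹ * (f x + b / δ * g x) := by
          gcongr
          exact hdec x

end Foster

/-! ### Arrivals and their assignment to stations. -/

section Arrivals

lemma HasMean.pmfMean_eq {q : PMF ℕ} {l : ℝ} (h : HasMean q l) :
    pmfMean q (fun n => (n : ℝ≥0∞)) = ENNReal.ofReal l := by
  rw [← h.tsum_eq, ENNReal.ofReal_tsum_of_nonneg (fun n => by positivity) h.summable]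
  refine tsum_congr fun n => ?_
  rw [ENNReal.ofReal_mul ENNReal.toReal_nonneg, ENNReal.ofReal_toReal (q.apply_ne_top n),
    ENNReal.ofReal_natCast]

lemma HasMean.nonneg {q : PMF ℕ} {l : ℝ} (h : HasMean q l) : 0 ≤ l :=
  HasSum.nonneg (fun n => by positivity) h

/-- A law on the natural numbers with mean less than one charges zero. -/
lemma HasMean.apply_zero_ne_zero {q : PMF ℕ} {l : ℝ} (h : HasMean q l) (hl : l < 1) :
    q 0 ≠ 0 := by
  intro h0
  have h1 : (1 : ℝ≥0∞) ≤ ENNReal.ofReal l := by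
    rw [← h.pmfMean_eq, ← q.tsum_coe]
    refine ENNReal.tsum_le_tsum fun n => ?_
    rcases Nat.eq_zero_or_pos n with rfl | hn
    · simp [h0]
    · exact le_mul_of_one_le_right' (Nat.one_le_cast.2 hn)
  rw [ENNReal.one_le_ofReal] at h1
  linarith

/-- The part of `n` above the threshold `K`. -/
def excess (K n : ℕ) : ℕ := if K < n then n else 0

/-- These are tails of the convergent series for the mean. -/
lemma HasMean.exists_pmfMean_excess_le {q : PMF ℕ} {l : ℝ} (h : HasMean q l) {δ : ℝ≥0∞}
    (hδ : 0 < δ) : ∃ K₀, ∀ K, K₀ ≤ K → pmfMean q (fun n => (excess K n : ℝ≥0∞)) ≤ δ := by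
  have hfin : ∑' n, q n * (n : ℝ≥0∞) ≠ ∞ := by
    have := h.pmfMean_eq
    unfold pmfMean at this
    rw [this]
    exact ENNReal.ofReal_ne_top
  obtain ⟨K₀, hK₀⟩ := ((ENNReal.tendsto_sum_nat_add _ hfin).eventually
    (ge_mem_nhds hδ)).exists_forall_of_atTop
  refine ⟨K₀, fun K hK => ?_⟩
  have hsplit := (ENNReal.summable (f := fun n => q (n + (K + 1)) *
    (excess K (n + (K + 1)) : ℝ≥0∞))).sum_add_tsum_nat_add' (f := fun n => q n * (excess K n : ℝ≥0∞))
  rw [pmfMean, ← hsplit, Finset.sum_eq_zero, zero_add]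
  · refine le_trans (ENNReal.tsum_le_tsum fun n => ?_) (hK₀ (K + 1) (by omega))
    simp [excess, show K < n + (K + 1) by omega]
  · intro n hn
    have : ¬ K < n := by have := Finset.mem_range.1 hn; omega
    simp [excess, this]

variable (M : ℕ) [NeZero M] (q : PMF ℕ)

lemma pmfMean_assign (φ : (Fin M → ℕ) → ℝ≥0∞) :
    pmfMean (assign M q) φ = pmfMean q fun n => pmfMean (PMF.uniformOfFintype (Fin n → Fin M))
      fun f => φ fun i => (Finset.univ.filter (f · = i)).card := by
  rw [assign, pmfMean_bind]
  congr 1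
  ext n
  rw [pmfMean_map]

lemma pmfMean_assign_total (φ : ℕ → ℝ≥0∞) :
    pmfMean (assign M q) (fun a => φ (∑ i, a i)) = pmfMean q φ := by
  rw [pmfMean_assign]
  congr 1
  ext n
  have (f : Fin n → Fin M) : ∑ i, (Finset.univ.filter (f · = i)).card = n := by
    rw [← Finset.card_eq_sum_card_fiberwise (fun _ _ => Finset.mem_coe.2 (Finset.mem_univ _))]
    simp
  simp only [this, pmfMean_const]

lemma pmfMean_assign_apply_eq (i j : Fin M) :
    pmfMean (assign M q) (fun a => (a i : ℝ≥0∞)) = pmfMean (assign M q) fun a => (a j : ℝ≥0∞) := by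
  rw [pmfMean_assign, pmfMean_assign]
  congr 1
  ext n
  unfold pmfMean
  -- Exchanging the stations `i` and `j` preserves the uniform law on assignments.
  rw [← ((Equiv.refl (Fin n)).arrowCongr (Equiv.swap i j)).tsum_eq]
  refine tsum_congr fun f => ?_
  simp only [PMF.uniformOfFintype_apply]
  congr 3
  ext k
  simp only [Equiv.arrowCongr_apply, Equiv.refl_symm, Equiv.coe_refl, Function.comp_apply, id,
    Finset.mem_filter, Finset.mem_univ, true_and]
  rw [Equiv.swap_apply_eq_iff, Equiv.swap_apply_left]

variable {M q}

lemma HasMean.pmfMean_assign_apply {l : ℝ} (h : HasMean q l) (i : Fin M) :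
    pmfMean (assign M q) (fun a => (a i : ℝ≥0∞)) = ENNReal.ofReal (l / M) := by
  have hM : (0 : ℝ) < M := by exact_mod_cast Nat.pos_of_ne_zero (NeZero.ne M)
  have htot := pmfMean_assign_total M q (fun n => (n : ℝ≥0∞))
  simp only [Nat.cast_sum, pmfMean_sum] at htot
  rw [Finset.sum_congr rfl fun j _ => pmfMean_assign_apply_eq M q j i, h.pmfMean_eq] at htot
  simp only [Finset.sum_const, Finset.card_univ, Fintype.card_fin, nsmul_eq_mul] at htot
  rw [ENNReal.ofReal_div_of_pos hM, ← htot, ENNReal.ofReal_natCast, mul_comm]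
  exact (ENNReal.mul_div_cancel_right (by exact_mod_cast NeZero.ne M)
    (ENNReal.natCast_ne_top M)).symm

lemma assign_zero_ne_zero (h : q 0 ≠ 0) : assign M q 0 ≠ 0 := by
  rw [← PMF.mem_support_iff, assign, PMF.mem_support_bind_iff]
  refine ⟨0, (PMF.mem_support_iff _ _).2 h, ?_⟩
  rw [PMF.mem_support_map_iff]
  exact ⟨Fin.elim0, by simp, by ext i; simp⟩

end Arrivals

/-! ### Probabilities of the transmission decisions. -/

section Decisions

variable (M : ℕ) (p : ℝ≥0) (hp : p ≤ 1)

/-- The probability of a combination of decisions. -/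
noncomputable def decisionWeight (α : Fin M → Bool) : ℝ := (decisions M p hp α).toReal

lemma decisionWeight_eq (α : Fin M → Bool) :
    decisionWeight M p hp α = ∏ i, if α i then (p : ℝ) else 1 - p := by
  have h1 : ∀ b : Bool, (if b then (p : ℝ≥0∞) else 1 - p).toReal = if b then (p : ℝ) else 1 - p := by
    intro b
    cases b
    · rw [if_neg (by simp), if_neg (by simp), ENNReal.toReal_sub_of_le (by exact_mod_cast hp) (by simp)]
      simp
    · simp
  rw [decisionWeight, decisions, PMF.ofFintype_apply, ENNReal.toReal_prod]
  exact Finset.prod_congr rfl fun i _ => h1 (α i)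

lemma decisionWeight_nonneg (α : Fin M → Bool) : 0 ≤ decisionWeight M p hp α :=
  ENNReal.toReal_nonneg

lemma sum_decisionWeight : ∑ α, decisionWeight M p hp α = 1 := by
  unfold decisionWeight
  rw [← ENNReal.toReal_sum fun α _ => PMF.apply_ne_top _ _, ← tsum_fintype (L := .unconditional _),
    PMF.tsum_coe, ENNReal.toReal_one]

lemma pmfMean_decisions_ofReal {φ : (Fin M → Bool) → ℝ} (hφ : ∀ α, 0 ≤ φ α) :
    pmfMean (decisions M p hp) (fun α => ENNReal.ofReal (φ α))
      = ENNReal.ofReal (∑ α, decisionWeight M p hp α * φ α) := by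
  rw [pmfMean, tsum_fintype, ENNReal.ofReal_sum_of_nonneg fun α _ =>
    mul_nonneg (decisionWeight_nonneg M p hp α) (hφ α)]
  refine Finset.sum_congr rfl fun α _ => ?_
  rw [ENNReal.ofReal_mul (decisionWeight_nonneg M p hp α), decisionWeight,
    ENNReal.ofReal_toReal (PMF.apply_ne_top _ _)]

lemma decisionWeight_single (i : Fin M) :
    decisionWeight M p hp (fun j => decide (j = i)) = p * (1 - p) ^ (M - 1) := by
  rw [decisionWeight_eq, ← Finset.mul_prod_erase _ _ (Finset.mem_univ i)]
  rw [Finset.prod_congr rfl (g := fun _ => 1 - (p : ℝ))]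
  · simp [Finset.card_erase_of_mem]
  · intro j hj
    simp [Finset.ne_of_mem_erase hj]

lemma sum_decisionWeight_false (i : Fin M) :
    ∑ α, decisionWeight M p hp α * (if α i = false then 1 else 0) = 1 - (p : ℝ) := by
  -- With the indicator written as a product over stations, the sum over `α` factorizes.
  have hprod (α : Fin M → Bool) : decisionWeight M p hp α * (if α i = false then 1 else 0)
      = ∏ j, ((if α j then (p : ℝ) else 1 - p) * if j = i then (if α j = false then 1 else 0) else 1) := by
    rw [Finset.prod_mul_distrib, ← decisionWeight_eq M p hp, Finset.prod_ite_eq' Finset.univ i]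
    simp
  simp only [hprod]
  rw [← Fintype.prod_sum fun (j : Fin M) (b : Bool) =>
    (if b then (p : ℝ) else 1 - p) * if j = i then (if b = false then 1 else 0) else 1]
  rw [Finset.prod_eq_single i]
  · simp
  · intro j _ hj
    simp [hj]
  · simp

end Decisions

/-! ### The smooth norm and its increments. -/

section Norm

variable {ι : Type*} [Fintype ι]

/-- A smooth version of the Euclidean norm. -/
noncomputable def smoothNorm (u : ι → ℝ) : ℝ := √(1 + ∑ j, u j ^ 2)

lemma smoothNorm_sq (u : ι → ℝ) : smoothNorm u ^ 2 = 1 + ∑ j, u j ^ 2 :=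
  Real.sq_sqrt (by positivity)

lemma one_le_smoothNorm (u : ι → ℝ) : 1 ≤ smoothNorm u :=
  Real.one_le_sqrt.2 (le_add_of_nonneg_right (by positivity))

lemma smoothNorm_pos (u : ι → ℝ) : 0 < smoothNorm u := one_pos.trans_le (one_le_smoothNorm u)

lemma le_smoothNorm (u : ι → ℝ) (j : ι) : u j ≤ smoothNorm u := by
  refine Real.le_sqrt_of_sq_le ?_
  have := Finset.single_le_sum (f := fun j => u j ^ 2) (fun j _ => sq_nonneg _) (Finset.mem_univ j)
  linarith

lemma smoothNorm_le_one_add_sum {u : ι → ℝ} (hu : ∀ j, 0 ≤ u j) :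
    smoothNorm u ≤ 1 + ∑ j, u j := by
  have hs : 0 ≤ ∑ j, u j := Finset.sum_nonneg fun j _ => hu j
  refine Real.sqrt_le_iff.2 ⟨by linarith, ?_⟩
  have := Finset.sum_sq_le_sq_sum_of_nonneg (s := Finset.univ) fun j _ => hu j
  nlinarith

/-- A Lipschitz bound, for the large batches: it costs only a first moment. -/
lemma smoothNorm_add_le {u δ : ι → ℝ} (hδ : ∀ j, 0 ≤ δ j) :
    smoothNorm (fun j => u j + δ j) ≤ smoothNorm u + ∑ j, δ j := by
  have hs : 0 ≤ ∑ j, δ j := Finset.sum_nonneg fun j _ => hδ j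
  refine Real.sqrt_le_iff.2 ⟨add_nonneg (smoothNorm_pos u).le hs, ?_⟩
  have h1 := Finset.sum_sq_le_sq_sum_of_nonneg (s := Finset.univ) fun j _ => hδ j
  have h2 : ∑ j, u j * δ j ≤ smoothNorm u * ∑ j, δ j := by
    rw [Finset.mul_sum]
    exact Finset.sum_le_sum fun j _ => mul_le_mul_of_nonneg_right (le_smoothNorm u j) (hδ j)
  have h3 : ∑ j, (u j + δ j) ^ 2 = ∑ j, u j ^ 2 + 2 * ∑ j, u j * δ j + ∑ j, δ j ^ 2 := by
    rw [Finset.mul_sum, ← Finset.sum_add_distrib, ← Finset.sum_add_distrib]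
    exact Finset.sum_congr rfl fun j _ => by ring
  nlinarith [smoothNorm_sq u]

/-- Concavity of the root: `n' - n ≤ (n'^2 - n^2) / (2n)`, which is `(n' - n)^2 ≥ 0`. -/
lemma smoothNorm_add_le_linear (u ξ : ι → ℝ) {C : ℝ} (hC : ∑ j, ξ j ^ 2 ≤ 2 * C) :
    smoothNorm (fun j => u j + ξ j) ≤ smoothNorm u + (∑ j, u j * ξ j + C) / smoothNorm u := by
  have hpos := smoothNorm_pos u
  have h3 : ∑ j, (u j + ξ j) ^ 2 = ∑ j, u j ^ 2 + 2 * ∑ j, u j * ξ j + ∑ j, ξ j ^ 2 := by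
    rw [Finset.mul_sum, ← Finset.sum_add_distrib, ← Finset.sum_add_distrib]
    exact Finset.sum_congr rfl fun j _ => by ring
  rw [← sub_le_iff_le_add', le_div_iff₀ hpos]
  nlinarith [smoothNorm_sq u, smoothNorm_sq fun j => u j + ξ j,
    sq_nonneg (smoothNorm (fun j => u j + ξ j) - smoothNorm u)]

/-- Linearization of the norm, where the part `ν₂` of the increment need not be bounded. -/
lemma smoothNorm_add_le_linear_add {u d ν₁ ν₂ : ι → ℝ} {C : ℝ} (hu : ∀ j, 0 ≤ u j)
    (hν : ∀ j, 0 ≤ ν₂ j) (hC : ∑ j, (d j + ν₁ j) ^ 2 ≤ 2 * C) :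
    smoothNorm (fun j => u j + (d j + (ν₁ j + ν₂ j)))
      ≤ smoothNorm u + (∑ j, u j * (d j + (ν₁ j + ν₂ j)) + C) / smoothNorm u + ∑ j, ν₂ j := by
  have h1 := smoothNorm_add_le (u := fun j => u j + (d j + ν₁ j)) hν
  have h2 := smoothNorm_add_le_linear u (fun j => d j + ν₁ j) hC
  -- Since `u ≥ 0`, the linear term may also include `ν₂`; it then contains the full arrivals, whose
  -- means are known.
  have h3 : (∑ j, u j * (d j + ν₁ j) + C) / smoothNorm u
      ≤ (∑ j, u j * (d j + (ν₁ j + ν₂ j)) + C) / smoothNorm u := by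
    refine div_le_div_of_nonneg_right ?_ (smoothNorm_pos u).le
    refine add_le_add (Finset.sum_le_sum fun j _ => ?_) le_rfl
    exact mul_le_mul_of_nonneg_left (by linarith [hν j]) (hu j)
  simp only [add_assoc] at h1 h2 h3 ⊢
  linarith

end Norm

/-! ### The loads of the stations and their one-step increments. -/

section Step

variable {M : ℕ}

open Classical in
/-- The number of red messages which leave station `i`. -/
noncomputable def redServed (s : State M) (α : Fin M → Bool) (i : Fin M) : ℝ :=
  if s.RedSuccess α i then 1 else 0

open Classical in
/-- The number of green messages which leave station `i`. -/
noncomputable def greenServed (s : State M) (α : Fin M → Bool) (i : Fin M) : ℝ :=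
  if s.GreenSuccess α i then 1 else 0

/-- The number of slots until station `i` is scheduled. -/
def State.wait (s : State M) (i : Fin M) : ℕ := (i - s.scheduled : Fin M)

lemma redServed_nonneg (s : State M) (α : Fin M → Bool) (i : Fin M) : 0 ≤ redServed s α i := by
  unfold redServed; split_ifs <;> simp

lemma redServed_le_one (s : State M) (α : Fin M → Bool) (i : Fin M) : redServed s α i ≤ 1 := by
  unfold redServed; split_ifs <;> simp

lemma greenServed_nonneg (s : State M) (α : Fin M → Bool) (i : Fin M) :
    0 ≤ greenServed s α i := by
  unfold greenServed; split_ifs <;> simp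

lemma greenServed_le_one (s : State M) (α : Fin M → Bool) (i : Fin M) : greenServed s α i ≤ 1 := by
  unfold greenServed; split_ifs <;> simp

lemma next_red [NeZero M] (s : State M) (a b : Fin M → ℕ) (α : Fin M → Bool) (i : Fin M) :
    ((s.next a b α).red i : ℝ) = s.red i - redServed s α i + a i := by
  unfold redServed State.next
  by_cases h : s.RedSuccess α i
  · have : 1 ≤ s.red i := h.1.2
    simp [h, this]
  · simp [h]

lemma next_green [NeZero M] (s : State M) (a b : Fin M → ℕ) (α : Fin M → Bool) (i : Fin M) :
    ((s.next a b α).green i : ℝ) = s.green i - greenServed s α i + b i := by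
  unfold greenServed State.next
  by_cases h : s.GreenSuccess α i
  · have : 1 ≤ s.green i := h.1.1
    simp [h, this]
  · simp [h]

lemma wait_eq_zero_iff [NeZero M] (s : State M) (i : Fin M) : s.wait i = 0 ↔ i = s.scheduled := by
  rw [State.wait, Fin.val_eq_zero_iff, sub_eq_zero]

/-- The wait drops by one, except that the scheduled station jumps from `0` to `M - 1`. The added
`1` avoids truncated subtraction. -/
lemma next_wait [NeZero M] (s : State M) (a b : Fin M → ℕ) (α : Fin M → Bool) (i : Fin M) :
    (s.next a b α).wait i + 1 = s.wait i + if i = s.scheduled then M else 0 := by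
  have hM : 0 < M := Nat.pos_of_ne_zero (NeZero.ne M)
  have h1 : (s.next a b α).wait i = ((i - s.scheduled - 1 : Fin M) : ℕ) := by
    rw [State.wait, State.next, sub_add_eq_sub_sub]
  have h2 : s.wait i = ((i - s.scheduled : Fin M) : ℕ) := rfl
  simp only [h1, ← wait_eq_zero_iff s i, h2]
  generalize i - s.scheduled = k
  have h3 : ((k - 1 : Fin M) : ℕ) = if k = 0 then M - 1 else k - 1 := by
    obtain ⟨m, rfl⟩ : ∃ m, M = m + 1 := ⟨M - 1, by omega⟩
    rw [Fin.coe_sub_one]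
    rfl
  rw [h3]
  by_cases h : k = 0
  · simp [h]; omega
  · have h' : (k : ℕ) ≠ 0 := fun h'' => h (Fin.ext (by simpa using h''))
    simp [h, h']; omega

lemma next_wait_cast [NeZero M] (s : State M) (a b : Fin M → ℕ) (α : Fin M → Bool) (i : Fin M) :
    ((s.next a b α).wait i : ℝ) = s.wait i + ((if i = s.scheduled then (M : ℝ) else 0) - 1) := by
  have h := congrArg (Nat.cast (R := ℝ)) (next_wait s a b α i)
  push_cast at h
  split_ifs at h ⊢ <;> linarith

/-- For every station, a combination of its queue lengths whose drift is negative when its green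
queue is not empty, and one of the red queue length and the waiting time whose drift is
negative when its red queue is not empty. -/
def load (κ γ θ : ℝ) (s : State M) : Fin M ⊕ Fin M → ℝ
  | .inl i => s.green i + κ * s.red i
  | .inr i => γ * (s.red i + θ * s.wait i)

/-- The part of the increment of `load` which is not due to the arrivals. -/
noncomputable def loadService (κ γ θ : ℝ) (s : State M) (α : Fin M → Bool) : Fin M ⊕ Fin M → ℝ
  | .inl i => -(greenServed s α i + κ * redServed s α i)
  | .inr i => γ * (θ * ((if i = s.scheduled then (M : ℝ) else 0) - 1) - redServed s α i)

/-- The part of the increment of `load` which is due to the arrivals. -/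
def loadArrival (κ γ : ℝ) (a b : Fin M → ℕ) : Fin M ⊕ Fin M → ℝ
  | .inl i => b i + κ * a i
  | .inr i => γ * a i

lemma load_next [NeZero M] (κ γ θ : ℝ) (s : State M) (a b : Fin M → ℕ) (α : Fin M → Bool) :
    load κ γ θ (s.next a b α)
      = fun j => load κ γ θ s j + (loadService κ γ θ s α j + loadArrival κ γ a b j) := by
  ext j
  rcases j with i | i
  · simp only [load, loadService, loadArrival, next_red, next_green]; ring
  · simp only [load, loadService, loadArrival, next_red, next_wait_cast]; ring

lemma load_nonneg {κ γ θ : ℝ} (hκ : 0 ≤ κ) (hγ : 0 ≤ γ) (hθ : 0 ≤ θ) (s : State M)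
    (j : Fin M ⊕ Fin M) : 0 ≤ load κ γ θ s j := by
  rcases j with i | i <;> simp only [load] <;> positivity

lemma loadArrival_nonneg {κ γ : ℝ} (hκ : 0 ≤ κ) (hγ : 0 ≤ γ) (a b : Fin M → ℕ)
    (j : Fin M ⊕ Fin M) : 0 ≤ loadArrival κ γ a b j := by
  rcases j with i | i <;> simp only [loadArrival] <;> positivity

lemma sum_loadArrival (κ γ : ℝ) (a b : Fin M → ℕ) :
    ∑ j, loadArrival κ γ a b j = ((∑ i, b i : ℕ) : ℝ) + (κ + γ) * ((∑ i, a i : ℕ) : ℝ) := by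
  simp only [Fintype.sum_sum_type, loadArrival, Finset.sum_add_distrib, ← Finset.mul_sum,
    Nat.cast_sum]
  ring

lemma abs_loadService_le [NeZero M] {κ γ θ : ℝ} (hκ : 0 ≤ κ) (hγ : 0 ≤ γ) (hθ : 0 ≤ θ) (s : State M)
    (α : Fin M → Bool) (j : Fin M ⊕ Fin M) :
    |loadService κ γ θ s α j| ≤ 1 + κ + γ * (θ * M + 1) := by
  have hM : (1 : ℝ) ≤ M := by exact_mod_cast Nat.pos_of_ne_zero (NeZero.ne M)
  rcases j with i | i
  · have h1 := greenServed_nonneg s α i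
    have h2 := greenServed_le_one s α i
    have h3 := mul_nonneg hκ (redServed_nonneg s α i)
    have h4 := mul_le_mul_of_nonneg_left (redServed_le_one s α i) hκ
    have h5 : 0 ≤ γ * (θ * M + 1) := by positivity
    simp only [loadService, abs_neg]
    rw [abs_of_nonneg (by positivity)]
    linarith
  · simp only [loadService, abs_mul, abs_of_nonneg hγ]
    have h : |θ * ((if i = s.scheduled then (M : ℝ) else 0) - 1) - redServed s α i| ≤ θ * M + 1 := by
      have h1 := redServed_nonneg s α i
      have h2 := redServed_le_one s α i
      have h3 := mul_le_mul_of_nonneg_left hM hθ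
      rw [abs_le]
      split_ifs <;> constructor <;> nlinarith
    have := mul_le_mul_of_nonneg_left h hγ
    linarith

/-- Arrivals discarded if there are more than `K` of them. -/
def truncate (K : ℕ) (a : Fin M → ℕ) : Fin M → ℕ := if K < ∑ i, a i then 0 else a

lemma sum_truncate_le (K : ℕ) (a : Fin M → ℕ) : ∑ i, truncate K a i ≤ K := by
  unfold truncate
  split_ifs with h
  · simp
  · exact not_lt.1 h

lemma truncate_le (K : ℕ) (a : Fin M → ℕ) : truncate K a ≤ a := by
  unfold truncate
  split_ifs with h
  · exact fun i => Nat.zero_le _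
  · exact le_rfl

lemma sum_sub_truncate (K : ℕ) (a : Fin M → ℕ) :
    ∑ i, (a - truncate K a) i = excess K (∑ i, a i) := by
  unfold truncate excess
  split_ifs with h <;> simp

/-- A bound for the second moments of the increments when at most `K` messages of each colour
arrive. -/
noncomputable def curvature (M : ℕ) (κ γ θ : ℝ) (K : ℕ) : ℝ :=
  M * (1 + κ + γ * (θ * M + 1) + (K + (κ + γ) * K)) ^ 2

lemma smoothNorm_load_next_le [NeZero M] {κ γ θ : ℝ} (hκ : 0 ≤ κ) (hγ : 0 ≤ γ) (hθ : 0 ≤ θ) (K : ℕ)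
    (s : State M) (a b : Fin M → ℕ) (α : Fin M → Bool) :
    smoothNorm (load κ γ θ (s.next a b α)) ≤ smoothNorm (load κ γ θ s)
      + (∑ j, load κ γ θ s j * loadService κ γ θ s α j
          + ∑ j, load κ γ θ s j * loadArrival κ γ a b j + curvature M κ γ θ K)
        / smoothNorm (load κ γ θ s)
      + ((excess K (∑ i, b i) : ℝ) + (κ + γ) * (excess K (∑ i, a i) : ℝ)) := by
  have hsplit (j : Fin M ⊕ Fin M) : loadArrival κ γ a b j
      = loadArrival κ γ (truncate K a) (truncate K b) j
        + loadArrival κ γ (a - truncate K a) (b - truncate K b) j := by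
    have ha (i : Fin M) : (((a - truncate K a) i : ℕ) : ℝ) = a i - truncate K a i := by
      rw [Pi.sub_apply, Nat.cast_sub (truncate_le K a i)]
    have hb (i : Fin M) : (((b - truncate K b) i : ℕ) : ℝ) = b i - truncate K b i := by
      rw [Pi.sub_apply, Nat.cast_sub (truncate_le K b i)]
    rcases j with i | i <;> simp only [loadArrival, ha, hb] <;> ring
  have hbound (j : Fin M ⊕ Fin M) : (loadService κ γ θ s α j
      + loadArrival κ γ (truncate K a) (truncate K b) j) ^ 2
      ≤ (1 + κ + γ * (θ * M + 1) + (K + (κ + γ) * K)) ^ 2 := by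
    refine sq_le_sq' ?_ ?_
    all_goals
      have h1 := abs_le.1 (abs_loadService_le hκ hγ hθ s α j)
      have h2 := loadArrival_nonneg hκ hγ (truncate K a) (truncate K b) j
      have h3 : loadArrival κ γ (truncate K a) (truncate K b) j ≤ K + (κ + γ) * K := by
        refine (Finset.single_le_sum (fun j _ => loadArrival_nonneg hκ hγ _ _ j)
          (Finset.mem_univ j)).trans ?_
        rw [sum_loadArrival]
        have h4 : ((∑ i, truncate K a i : ℕ) : ℝ) ≤ K := by exact_mod_cast sum_truncate_le K a
        have h5 : ((∑ i, truncate K b i : ℕ) : ℝ) ≤ K := by exact_mod_cast sum_truncate_le K b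
        have h6 := mul_le_mul_of_nonneg_left h4 (add_nonneg hκ hγ)
        linarith
      linarith [h1.1, h1.2]
  have hC : ∑ j, (loadService κ γ θ s α j + loadArrival κ γ (truncate K a) (truncate K b) j) ^ 2
      ≤ 2 * curvature M κ γ θ K := by
    -- There are `2M` coordinates, hence twice the curvature.
    refine (Finset.sum_le_sum fun j _ => hbound j).trans_eq ?_
    simp only [Finset.sum_const, Finset.card_univ, Fintype.card_sum, Fintype.card_fin, nsmul_eq_mul,
      curvature]
    push_cast
    ring
  have h := smoothNorm_add_le_linear_add (load_nonneg hκ hγ hθ s)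
    (loadArrival_nonneg hκ hγ (a - truncate K a) (b - truncate K b)) hC
  simp only [← hsplit] at h
  rw [sum_loadArrival, sum_sub_truncate, sum_sub_truncate] at h
  rw [load_next]
  refine h.trans_eq ?_
  simp only [mul_add, Finset.sum_add_distrib]

end Step

/-! ### The empty state is reached from everywhere. -/

section Reachability

lemma decisions_ne_zero {M : ℕ} {p : ℝ≥0} {hp : p ≤ 1} (h0 : 0 < p) (h1 : p < 1) (α : Fin M → Bool) :
    decisions M p hp α ≠ 0 := by
  rw [decisions, PMF.ofFintype_apply, Finset.prod_ne_zero_iff]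
  intro i _
  cases α i
  · simpa [tsub_eq_zero_iff_le] using h1
  · simpa using h0.ne'

variable {M : ℕ} [NeZero M] {p : ℝ≥0} {hp : p ≤ 1} {redLaw greenLaw : PMF ℕ}

lemma transition_next_ne_zero (h0 : 0 < p) (h1 : p < 1) (hR : redLaw 0 ≠ 0) (hG : greenLaw 0 ≠ 0)
    (s : State M) (α : Fin M → Bool) :
    transition M p hp redLaw greenLaw s (s.next 0 0 α) ≠ 0 := by
  rw [← PMF.mem_support_iff, transition, PMF.mem_support_bind_iff]
  refine ⟨0, (PMF.mem_support_iff _ _).2 (assign_zero_ne_zero hR), ?_⟩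
  rw [PMF.mem_support_bind_iff]
  refine ⟨0, (PMF.mem_support_iff _ _).2 (assign_zero_ne_zero hG), ?_⟩
  rw [PMF.mem_support_map_iff]
  exact ⟨α, (PMF.mem_support_iff _ _).2 (decisions_ne_zero h0 h1 α), rfl⟩

lemma reaches_next (h0 : 0 < p) (h1 : p < 1) (hR : redLaw 0 ≠ 0) (hG : greenLaw 0 ≠ 0)
    (s : State M) (α : Fin M → Bool) :
    Reaches (transition M p hp redLaw greenLaw) s (s.next 0 0 α) :=
  .single (transition_next_ne_zero h0 h1 hR hG s α)

/-- Without arrivals and green attempts, a red message leaves at the latest when station `i` gets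
its turn. -/
lemma exists_reaches_sum_red_lt (h0 : 0 < p) (h1 : p < 1) (hR : redLaw 0 ≠ 0)
    (hG : greenLaw 0 ≠ 0) (i : Fin M) (s : State M) (hi : 0 < s.red i) :
    ∃ s', Reaches (transition M p hp redLaw greenLaw) s s' ∧ ∑ j, s'.red j < ∑ j, s.red j := by
  induction hk : s.wait i generalizing s with
  | zero =>
    refine ⟨_, reaches_next h0 h1 hR hG s fun _ => false, ?_⟩
    have hs := (wait_eq_zero_iff s i).1 hk
    refine Finset.sum_lt_sum (fun j _ => ?_) ⟨i, Finset.mem_univ i, ?_⟩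
    · simp [State.next]
    · have : s.RedSuccess (fun _ => false) i := ⟨⟨hs, hi⟩, fun h => by simpa using h.2⟩
      simp [State.next, this, hi]
  | succ k ih =>
    by_cases hs : 0 < s.red s.scheduled
    · refine ⟨_, reaches_next h0 h1 hR hG s fun _ => false, ?_⟩
      refine Finset.sum_lt_sum (fun j _ => ?_) ⟨s.scheduled, Finset.mem_univ _, ?_⟩
      · simp [State.next]
      · have : s.RedSuccess (fun _ => false) s.scheduled :=
          ⟨⟨rfl, hs⟩, fun h => by simpa using h.2⟩
        simp [State.next, this, hs]
    · have hred : (s.next 0 0 fun _ => false).red = s.red := by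
        ext j
        have : ¬ s.RedSuccess (fun _ => false) j := fun h => hs (h.1.1 ▸ h.1.2)
        simp [State.next, this]
      have hne : i ≠ s.scheduled := fun h => hs (h ▸ hi)
      have hw := next_wait s 0 0 (fun _ => false) i
      rw [if_neg hne, hk] at hw
      obtain ⟨s', h, h'⟩ := ih (s.next 0 0 fun _ => false) (by rwa [hred]) (by omega)
      exact ⟨s', (reaches_next h0 h1 hR hG s _).trans h, by rwa [hred] at h'⟩

lemma exists_reaches_red_eq_zero (h0 : 0 < p) (h1 : p < 1) (hR : redLaw 0 ≠ 0)
    (hG : greenLaw 0 ≠ 0) (s : State M) :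
    ∃ s', Reaches (transition M p hp redLaw greenLaw) s s' ∧ s'.red = 0 := by
  induction hn : ∑ j, s.red j using Nat.strong_induction_on generalizing s with
  | _ n ih =>
    by_cases h : s.red = 0
    · exact ⟨s, .refl, h⟩
    · obtain ⟨i, hi⟩ := Function.ne_iff.1 h
      obtain ⟨s', hs, hlt⟩ :=
        exists_reaches_sum_red_lt (hp := hp) h0 h1 hR hG i s (Nat.pos_of_ne_zero hi)
      obtain ⟨s'', hs', h''⟩ := ih _ (hn ▸ hlt) s' rfl
      exact ⟨s'', hs.trans hs', h''⟩

/-- Once no red is left, a station that alone decides to send green succeeds. -/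
lemma exists_reaches_empty (h0 : 0 < p) (h1 : p < 1) (hR : redLaw 0 ≠ 0)
    (hG : greenLaw 0 ≠ 0) (s : State M) (hs : s.red = 0) :
    ∃ s', Reaches (transition M p hp redLaw greenLaw) s s' ∧ s'.red = 0 ∧ s'.green = 0 := by
  induction hn : ∑ j, s.green j using Nat.strong_induction_on generalizing s with
  | _ n ih =>
    by_cases h : s.green = 0
    · exact ⟨s, .refl, hs, h⟩
    · obtain ⟨i, hi⟩ := Function.ne_iff.1 h
      have hi' : 0 < s.green i := Nat.pos_of_ne_zero hi
      let α : Fin M → Bool := fun j => decide (j = i)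
      have hred : (s.next 0 0 α).red = 0 := by
        ext j
        simp [State.next, hs]
      have hlt : ∑ j, (s.next 0 0 α).green j < ∑ j, s.green j := by
        refine Finset.sum_lt_sum (fun j _ => ?_) ⟨i, Finset.mem_univ i, ?_⟩
        · simp [State.next]
        · have : s.GreenSuccess α i :=
            ⟨⟨hi', by simp [α]⟩, fun j hj h => hj (by simpa [α] using h.2),
              fun h => by simp [State.RedAttempt, hs] at h⟩
          simp [State.next, this, hi']
      obtain ⟨s'', hs', h''⟩ := ih _ (hn ▸ hlt) _ hred rfl
      exact ⟨s'', (reaches_next h0 h1 hR hG s α).trans hs', h''⟩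

lemma reaches_scheduled_of_empty (h0 : 0 < p) (h1 : p < 1) (hR : redLaw 0 ≠ 0)
    (hG : greenLaw 0 ≠ 0) (i : Fin M) (s : State M) (hr : s.red = 0) (hg : s.green = 0) :
    Reaches (transition M p hp redLaw greenLaw) s ⟨i, 0, 0⟩ := by
  induction hk : s.wait i generalizing s with
  | zero =>
    have : s = ⟨i, 0, 0⟩ := State.ext ((wait_eq_zero_iff s i).1 hk).symm hr hg
    exact this ▸ .refl
  | succ k ih =>
    have hne : i ≠ s.scheduled := fun h => by
      have := (wait_eq_zero_iff s i).2 h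
      omega
    have hw := next_wait s 0 0 (fun _ => false) i
    rw [if_neg hne, hk] at hw
    refine (reaches_next h0 h1 hR hG s fun _ => false).trans (ih _ ?_ ?_ (by omega))
    · ext j; simp [State.next, hr]
    · ext j; simp [State.next, hg]

lemma reaches_empty (h0 : 0 < p) (h1 : p < 1) (hR : redLaw 0 ≠ 0) (hG : greenLaw 0 ≠ 0)
    (s : State M) : Reaches (transition M p hp redLaw greenLaw) s ⟨0, 0, 0⟩ := by
  obtain ⟨s₁, h₁, hr₁⟩ := exists_reaches_red_eq_zero (hp := hp) h0 h1 hR hG s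
  obtain ⟨s₂, h₂, hr₂, hg₂⟩ := exists_reaches_empty (hp := hp) h0 h1 hR hG s₁ hr₁
  exact (h₁.trans h₂).trans (reaches_scheduled_of_empty h0 h1 hR hG 0 s₂ hr₂ hg₂)

end Reachability

/-! ### Mean services and the drift of one station. -/

section Drift

variable {M : ℕ} {p : ℝ≥0} (hp : p ≤ 1)

/-- The mean number of red messages which leave station `i`. -/
noncomputable def meanRedServed (s : State M) (i : Fin M) : ℝ :=
  ∑ α, decisionWeight M p hp α * redServed s α i

/-- The mean number of green messages which leave station `i`. -/
noncomputable def meanGreenServed (s : State M) (i : Fin M) : ℝ :=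
  ∑ α, decisionWeight M p hp α * greenServed s α i

lemma meanRedServed_nonneg (s : State M) (i : Fin M) : 0 ≤ meanRedServed hp s i :=
  Finset.sum_nonneg fun α _ => mul_nonneg (decisionWeight_nonneg M p hp α) (redServed_nonneg s α i)

lemma meanGreenServed_nonneg (s : State M) (i : Fin M) : 0 ≤ meanGreenServed hp s i :=
  Finset.sum_nonneg fun α _ =>
    mul_nonneg (decisionWeight_nonneg M p hp α) (greenServed_nonneg s α i)

lemma le_meanRedServed {s : State M} {i : Fin M} (h : s.RedAttempt i) :
    1 - (p : ℝ) ≤ meanRedServed hp s i := by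
  rw [← sum_decisionWeight_false M p hp i]
  refine Finset.sum_le_sum fun α _ =>
    mul_le_mul_of_nonneg_left ?_ (decisionWeight_nonneg M p hp α)
  split_ifs with hα
  · have : s.RedSuccess α i := ⟨h, fun h' => by simp [State.GreenAttempt, hα] at h'⟩
    simp [redServed, this]
  · exact redServed_nonneg s α i

/-- The decision vector which is true only at `i` leads to success whatever the other queues are. -/
lemma le_meanGreenServed {s : State M} {i : Fin M} (hg : 0 < s.green i) (h : ¬ s.RedAttempt i) :
    (p : ℝ) * (1 - p) ^ (M - 1) ≤ meanGreenServed hp s i := by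
  let α : Fin M → Bool := fun j => decide (j = i)
  have hα : s.GreenSuccess α i :=
    ⟨⟨hg, by simp [α]⟩, fun j hj h => hj (by simpa [α] using h.2), h⟩
  calc (p : ℝ) * (1 - p) ^ (M - 1) = decisionWeight M p hp α * greenServed s α i := by
        rw [decisionWeight_single]
        simp [greenServed, hα]
    _ ≤ _ := Finset.single_le_sum (f := fun α => decisionWeight M p hp α * greenServed s α i)
        (fun α _ => mul_nonneg (decisionWeight_nonneg M p hp α) (greenServed_nonneg s α i))
        (Finset.mem_univ α)

lemma sum_decisionWeight_load_mul_loadService (κ γ θ : ℝ) (s : State M) :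
    ∑ α, decisionWeight M p hp α * ∑ j, load κ γ θ s j * loadService κ γ θ s α j
      = ∑ i, (load κ γ θ s (.inl i) * -(meanGreenServed hp s i + κ * meanRedServed hp s i)
        + load κ γ θ s (.inr i) * (γ * (θ * ((if i = s.scheduled then (M : ℝ) else 0) - 1)
          - meanRedServed hp s i))) := by
  simp only [Finset.mul_sum]
  rw [Finset.sum_comm, Fintype.sum_sum_type, ← Finset.sum_add_distrib]
  refine Finset.sum_congr rfl fun i _ => ?_
  have h1 := sum_decisionWeight M p hp
  have e1 : ∑ α, decisionWeight M p hp α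
        * (load κ γ θ s (.inl i) * loadService κ γ θ s α (.inl i))
      = load κ γ θ s (.inl i) * -(meanGreenServed hp s i + κ * meanRedServed hp s i) := by
    simp only [meanGreenServed, meanRedServed, Finset.mul_sum, ← Finset.sum_add_distrib,
      ← Finset.sum_neg_distrib]
    exact Finset.sum_congr rfl fun α _ => by simp only [loadService]; ring
  have e2 : ∑ α, decisionWeight M p hp α
        * (load κ γ θ s (.inr i) * loadService κ γ θ s α (.inr i))
      = load κ γ θ s (.inr i) * (γ * (θ * ((if i = s.scheduled then (M : ℝ) else 0) - 1)
          - meanRedServed hp s i)) := by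
    have : θ * ((if i = s.scheduled then (M : ℝ) else 0) - 1)
        = ∑ α, decisionWeight M p hp α * (θ * ((if i = s.scheduled then (M : ℝ) else 0) - 1)) := by
      rw [← Finset.sum_mul, h1, one_mul]
    rw [this, meanRedServed, ← Finset.sum_sub_distrib, Finset.mul_sum, Finset.mul_sum]
    exact Finset.sum_congr rfl fun α _ => by simp only [loadService]; ring
  rw [e1, e2]

/-- The loads of every station drift to zero if red and green messages arrive at it with rates
`a` and `g`. -/
lemma station_drift_le {κ γ θ a g c ε η : ℝ}
    (hc : c = p * (1 - p) ^ (M - 1)) (hκ : κ * (1 - p) = c) (hκ0 : 0 ≤ κ)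
    (hε : g + κ * a + ε = c) (hθ : θ * M = 1 - p) (hη : a + η = θ)
    (hθ0 : 0 ≤ θ) (hγ1 : 1 ≤ γ) (hγ : c * κ + ε ≤ η * γ) (s : State M) (i : Fin M) [NeZero M] :
    load κ γ θ s (.inl i)
        * (g + κ * a - (meanGreenServed hp s i + κ * meanRedServed hp s i))
      + load κ γ θ s (.inr i) * (γ * (a + θ * ((if i = s.scheduled then (M : ℝ) else 0) - 1)
          - meanRedServed hp s i))
      ≤ -ε * (load κ γ θ s (.inl i) + load κ γ θ s (.inr i)) := by
  have hp1 : (p : ℝ) ≤ 1 := hp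
  have hc0 : 0 ≤ c := hκ ▸ mul_nonneg hκ0 (by linarith)
  have hγ0 : 0 ≤ γ := by linarith
  have hr0 := meanRedServed_nonneg hp s i
  have hg0 := meanGreenServed_nonneg hp s i
  have hW0 := load_nonneg hκ0 hγ0 hθ0 s (.inl i)
  have hT0 := load_nonneg hκ0 hγ0 hθ0 s (.inr i)
  have hRT : (s.red i : ℝ) ≤ load κ γ θ s (.inr i) := by
    have h1 : (0 : ℝ) ≤ θ * s.wait i := by positivity
    have h2 : (0 : ℝ) ≤ s.red i := by positivity
    simp only [load]
    nlinarith
  have hW : load κ γ θ s (.inl i)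
      * (g + κ * a - (meanGreenServed hp s i + κ * meanRedServed hp s i))
      ≤ -ε * load κ γ θ s (.inl i) + c * κ * s.red i := by
    have hkr := mul_nonneg hκ0 hr0
    -- With no green messages the load is `κR`, and the term `cκR` bounds its possible growth.
    -- Otherwise the mean decrease through service is at least `c`, by red or by green.
    rcases Nat.eq_zero_or_pos (s.green i) with h0 | h0
    · have : load κ γ θ s (.inl i) = κ * s.red i := by simp [load, h0]
      have hk : 0 ≤ κ * s.red i := by positivity
      rw [this]
      nlinarith
    · have h : g + κ * a - (meanGreenServed hp s i + κ * meanRedServed hp s i) ≤ -ε := by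
        by_cases hred : s.RedAttempt i
        · have := mul_le_mul_of_nonneg_left (le_meanRedServed hp hred) hκ0
          linarith
        · have := le_meanGreenServed hp h0 hred
          linarith
      have h3 := mul_le_mul_of_nonneg_left h hW0
      have h4 : 0 ≤ c * κ * s.red i := by positivity
      linarith
  have hT : load κ γ θ s (.inr i) * (γ * (a + θ * ((if i = s.scheduled then (M : ℝ) else 0) - 1)
      - meanRedServed hp s i)) ≤ -(η * γ) * load κ γ θ s (.inr i) := by
    by_cases hzero : load κ γ θ s (.inr i) = 0
    · simp [hzero]
    have h : a + θ * ((if i = s.scheduled then (M : ℝ) else 0) - 1) - meanRedServed hp s i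
        ≤ -η := by
      split_ifs with hs
      · have hred : s.RedAttempt i := by
          refine ⟨hs, Nat.pos_of_ne_zero fun h0 => hzero ?_⟩
          simp [load, h0, (wait_eq_zero_iff s i).2 hs]
        have := le_meanRedServed hp hred
        linarith
      · linarith
    have h3 := mul_le_mul_of_nonneg_left (mul_le_mul_of_nonneg_left h hγ0) hT0
    linarith
  have h5 := mul_le_mul_of_nonneg_left hRT (mul_nonneg hc0 hκ0)
  have h6 := mul_le_mul_of_nonneg_right hγ hT0
  linarith

end Drift

/-! ### Mean of the Lyapunov function after one step. -/

section Mean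

variable {M : ℕ} [NeZero M]

lemma pmfMean_assign_linear_le {q : PMF ℕ} {l : ℝ} (h : HasMean q l) {c : Fin M → ℝ}
    (hc : ∀ i, 0 ≤ c i) {k δ : ℝ} (hk : 0 ≤ k) (hδ : 0 ≤ δ) {K : ℕ}
    (hK : pmfMean q (fun n => (excess K n : ℝ≥0∞)) ≤ ENNReal.ofReal δ) :
    pmfMean (assign M q) (fun a => ENNReal.ofReal (∑ i, c i * a i + k * excess K (∑ i, a i)))
      ≤ ENNReal.ofReal (∑ i, c i * (l / M) + k * δ) := by
  have hl : 0 ≤ l / M := div_nonneg h.nonneg (Nat.cast_nonneg M)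
  have hexp (a : Fin M → ℕ) : ENNReal.ofReal (∑ i, c i * a i + k * excess K (∑ i, a i))
      = ∑ i, ENNReal.ofReal (c i) * (a i : ℝ≥0∞)
        + ENNReal.ofReal k * (excess K (∑ i, a i) : ℝ≥0∞) := by
    rw [ENNReal.ofReal_add (Finset.sum_nonneg fun i _ => mul_nonneg (hc i) (Nat.cast_nonneg _))
      (by positivity), ENNReal.ofReal_mul hk, ENNReal.ofReal_natCast,
      ENNReal.ofReal_sum_of_nonneg fun i _ => mul_nonneg (hc i) (Nat.cast_nonneg _)]
    simp only [ENNReal.ofReal_mul (hc _), ENNReal.ofReal_natCast]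
  simp only [hexp]
  rw [pmfMean_add, pmfMean_sum, pmfMean_const_mul,
    pmfMean_assign_total M q fun n => (excess K n : ℝ≥0∞),
    ENNReal.ofReal_add (Finset.sum_nonneg fun i _ => mul_nonneg (hc i) hl) (by positivity),
    ENNReal.ofReal_mul hk, ENNReal.ofReal_sum_of_nonneg fun i _ => mul_nonneg (hc i) hl]
  simp only [pmfMean_const_mul, h.pmfMean_assign_apply, ENNReal.ofReal_mul (hc _)]
  gcongr

lemma pmfMean_transition (p : ℝ≥0) (hp : p ≤ 1) (redLaw greenLaw : PMF ℕ) (s : State M)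
    (φ : State M → ℝ≥0∞) :
    pmfMean (transition M p hp redLaw greenLaw s) φ = pmfMean (assign M redLaw) fun a =>
      pmfMean (assign M greenLaw) fun b => pmfMean (decisions M p hp) fun α =>
        φ (s.next a b α) := by
  simp only [transition, pmfMean_bind, pmfMean_map]

lemma pmfMean_smoothNorm_load_le {p : ℝ≥0} (hp : p ≤ 1) {redLaw greenLaw : PMF ℕ} {lR lG : ℝ}
    (hR : HasMean redLaw lR) (hG : HasMean greenLaw lG) {κ γ θ δ : ℝ} (hκ : 0 ≤ κ) (hγ : 0 ≤ γ)
    (hθ : 0 ≤ θ) (hδ : 0 ≤ δ) {K : ℕ}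
    (hKR : pmfMean redLaw (fun n => (excess K n : ℝ≥0∞)) ≤ ENNReal.ofReal δ)
    (hKG : pmfMean greenLaw (fun n => (excess K n : ℝ≥0∞)) ≤ ENNReal.ofReal δ) (s : State M) :
    pmfMean (transition M p hp redLaw greenLaw s)
        (fun t => ENNReal.ofReal (smoothNorm (load κ γ θ t)))
      ≤ ENNReal.ofReal (smoothNorm (load κ γ θ s)
        + (∑ i, (load κ γ θ s (.inl i) * (lG / M + κ * (lR / M)
              - (meanGreenServed hp s i + κ * meanRedServed hp s i))
            + load κ γ θ s (.inr i) * (γ * (lR / M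
                + θ * ((if i = s.scheduled then (M : ℝ) else 0) - 1) - meanRedServed hp s i)))
          + curvature M κ γ θ K) / smoothNorm (load κ γ θ s) + (1 + κ + γ) * δ) := by
  set u := load κ γ θ s with hu
  set n := smoothNorm u with hn
  have hn0 : 0 < n := smoothNorm_pos u
  have hu0 : ∀ j, 0 ≤ u j := load_nonneg hκ hγ hθ s
  let c₀ : (Fin M → Bool) → ℝ := fun α =>
    n + (∑ j, u j * loadService κ γ θ s α j + curvature M κ γ θ K) / n
  let cR : Fin M → ℝ := fun i => (κ * u (.inl i) + γ * u (.inr i)) / n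
  let cG : Fin M → ℝ := fun i => u (.inl i) / n
  have hcR : ∀ i, 0 ≤ cR i := fun i =>
    div_nonneg (add_nonneg (mul_nonneg hκ (hu0 _)) (mul_nonneg hγ (hu0 _))) hn0.le
  have hcG : ∀ i, 0 ≤ cG i := fun i => div_nonneg (hu0 _) hn0.le
  have hpt (a b : Fin M → ℕ) (α : Fin M → Bool) : smoothNorm (load κ γ θ (s.next a b α))
      ≤ c₀ α + (∑ i, cR i * a i + (κ + γ) * excess K (∑ i, a i))
        + (∑ i, cG i * b i + 1 * excess K (∑ i, b i)) := by
    refine (smoothNorm_load_next_le hκ hγ hθ K s a b α).trans_eq ?_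
    have : (∑ j, u j * loadArrival κ γ a b j) / n = ∑ i, cR i * a i + ∑ i, cG i * b i := by
      rw [Fintype.sum_sum_type, ← Finset.sum_add_distrib, ← Finset.sum_add_distrib,
        Finset.sum_div]
      refine Finset.sum_congr rfl fun i _ => ?_
      simp only [loadArrival, cR, cG]
      ring
    simp only [c₀]
    rw [← hu, ← hn, add_right_comm (∑ j, u j * loadService κ γ θ s α j), add_div, this]
    ring
  -- Needed because `ENNReal.ofReal` cuts off negative values; the bound without arrivals dominates
  -- a norm.
  have hc₀ : ∀ α, 0 ≤ c₀ α := fun α => by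
    have h := (smoothNorm_pos _).le.trans (hpt 0 0 α)
    simpa [excess] using h
  calc _ ≤ pmfMean (assign M redLaw) fun a => pmfMean (assign M greenLaw) fun b =>
        pmfMean (decisions M p hp) fun α => ENNReal.ofReal (c₀ α)
          + ENNReal.ofReal (∑ i, cR i * a i + (κ + γ) * excess K (∑ i, a i))
          + ENNReal.ofReal (∑ i, cG i * b i + 1 * excess K (∑ i, b i)) := by
        rw [pmfMean_transition]
        refine pmfMean_mono _ fun a => pmfMean_mono _ fun b => pmfMean_mono _ fun α => ?_
        exact (ENNReal.ofReal_le_ofReal (hpt a b α)).trans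
          (ENNReal.ofReal_add_le.trans (add_le_add ENNReal.ofReal_add_le le_rfl))
    _ ≤ ENNReal.ofReal (∑ α, decisionWeight M p hp α * c₀ α)
          + ENNReal.ofReal (∑ i, cR i * (lR / M) + (κ + γ) * δ)
          + ENNReal.ofReal (∑ i, cG i * (lG / M) + 1 * δ) := by
        simp only [pmfMean_add, pmfMean_const]
        rw [pmfMean_decisions_ofReal M p hp hc₀]
        exact add_le_add (add_le_add le_rfl
          (pmfMean_assign_linear_le hR hcR (add_nonneg hκ hγ) hδ hKR))
          (pmfMean_assign_linear_le hG hcG zero_le_one hδ hKG)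
    _ = _ := by
        have hR0 : 0 ≤ lR / M := div_nonneg hR.nonneg (Nat.cast_nonneg M)
        have hG0 : 0 ≤ lG / M := div_nonneg hG.nonneg (Nat.cast_nonneg M)
        have p1 : 0 ≤ ∑ α, decisionWeight M p hp α * c₀ α :=
          Finset.sum_nonneg fun α _ => mul_nonneg (decisionWeight_nonneg M p hp α) (hc₀ α)
        have p2 : 0 ≤ ∑ i, cR i * (lR / M) + (κ + γ) * δ :=
          add_nonneg (Finset.sum_nonneg fun i _ => mul_nonneg (hcR i) hR0) (by positivity)
        have p3 : 0 ≤ ∑ i, cG i * (lG / M) + 1 * δ :=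
          add_nonneg (Finset.sum_nonneg fun i _ => mul_nonneg (hcG i) hG0) (by positivity)
        rw [← ENNReal.ofReal_add p1 p2, ← ENNReal.ofReal_add (add_nonneg p1 p2) p3]
        congr 1
        have e1 : ∑ α, decisionWeight M p hp α * c₀ α = n
            + ((∑ α, decisionWeight M p hp α * ∑ j, u j * loadService κ γ θ s α j)
              + curvature M κ γ θ K) / n := by
          have hw := sum_decisionWeight M p hp
          have : ∀ α, decisionWeight M p hp α * c₀ α = decisionWeight M p hp α
              * (n + curvature M κ γ θ K / n)
              + (decisionWeight M p hp α * ∑ j, u j * loadService κ γ θ s α j) / n := by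
            intro α
            simp only [c₀]
            ring
          simp only [this, Finset.sum_add_distrib, ← Finset.sum_mul, ← Finset.sum_div, hw]
          ring
        have e2 : ∑ i, cR i * (lR / M)
            = (∑ i, (κ * u (.inl i) + γ * u (.inr i)) * (lR / M)) / n := by
          rw [Finset.sum_div]
          exact Finset.sum_congr rfl fun i _ => by simp only [cR]; ring
        have e3 : ∑ i, cG i * (lG / M) = (∑ i, u (.inl i) * (lG / M)) / n := by
          rw [Finset.sum_div]
          exact Finset.sum_congr rfl fun i _ => by simp only [cG]; ring
        have e4 : ∑ i, (u (.inl i) * (lG / M + κ * (lR / M)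
              - (meanGreenServed hp s i + κ * meanRedServed hp s i))
            + u (.inr i) * (γ * (lR / M
                + θ * ((if i = s.scheduled then (M : ℝ) else 0) - 1) - meanRedServed hp s i)))
            = (∑ α, decisionWeight M p hp α * ∑ j, u j * loadService κ γ θ s α j)
              + ∑ i, (κ * u (.inl i) + γ * u (.inr i)) * (lR / M)
              + ∑ i, u (.inl i) * (lG / M) := by
          rw [hu, sum_decisionWeight_load_mul_loadService, ← Finset.sum_add_distrib,
            ← Finset.sum_add_distrib]
          exact Finset.sum_congr rfl fun i _ => by ring
        rw [e1, e2, e3, e4]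
        ring

end Mean

/-! ### Choice of the constants and conclusion. -/

instance (M : ℕ) : Countable (State M) :=
  Function.Injective.countable (f := fun s : State M => (s.scheduled, s.red, s.green))
    fun s t h => by
      simp only [Prod.mk.injEq] at h
      exact State.ext h.1 h.2.1 h.2.2

lemma finite_setOf_smoothNorm_load_lt {M : ℕ} {κ γ θ : ℝ} (hκ : 0 ≤ κ) (hγ : 1 ≤ γ) (hθ : 0 ≤ θ)
    (B : ℝ) : {s : State M | smoothNorm (load κ γ θ s) < B}.Finite := by
  have hfin : ((Set.univ : Set (Fin M)) ×ˢ (Set.Icc (0 : Fin M → ℕ) fun _ => ⌈B⌉₊) ×ˢ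
      (Set.Icc (0 : Fin M → ℕ) fun _ => ⌈B⌉₊)).Finite :=
    Set.finite_univ.prod ((Set.finite_Icc _ _).prod (Set.finite_Icc _ _))
  refine (hfin.preimage (f := fun s : State M => (s.scheduled, s.red, s.green))
    fun s _ t _ h => ?_).subset fun s hs => ?_
  · simp only [Prod.mk.injEq] at h
    exact State.ext h.1 h.2.1 h.2.2
  · have hbound {n : ℕ} {j : Fin M ⊕ Fin M} (h : (n : ℝ) ≤ load κ γ θ s j) : n ≤ ⌈B⌉₊ := by
      have h1 := (h.trans (le_smoothNorm _ j)).trans (le_of_lt hs)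
      exact_mod_cast h1.trans (Nat.le_ceil B)
    refine ⟨Set.mem_univ _, ⟨fun i => Nat.zero_le _, fun i => ?_⟩,
      ⟨fun i => Nat.zero_le _, fun i => ?_⟩⟩
    · refine hbound (j := .inr i) ?_
      have h1 : (0 : ℝ) ≤ θ * s.wait i := by positivity
      have h2 : (0 : ℝ) ≤ s.red i := by positivity
      simp only [load]
      nlinarith
    · refine hbound (j := .inl i) ?_
      have : (0 : ℝ) ≤ κ * s.red i := by positivity
      simp only [load]
      linarith

/-- The events that exactly station `i` decides to send are disjoint. This yields `lG < 1`, hence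
slots without green arrivals. -/
lemma card_mul_decisionWeight_single_le_one (M : ℕ) {p : ℝ≥0} (hp : p ≤ 1) :
    (M : ℝ) * (p * (1 - p) ^ (M - 1)) ≤ 1 := by
  have hinj : Function.Injective fun i : Fin M => fun j : Fin M => decide (j = i) := by
    intro i i' h
    simpa using congrFun h i
  calc (M : ℝ) * (p * (1 - p) ^ (M - 1))
      = ∑ i : Fin M, decisionWeight M p hp fun j => decide (j = i) := by
        simp [decisionWeight_single]
    _ = ∑ α ∈ Finset.univ.map ⟨_, hinj⟩, decisionWeight M p hp α := by rw [Finset.sum_map]; rfl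
    _ ≤ ∑ α, decisionWeight M p hp α := Finset.sum_le_sum_of_subset_of_nonneg
        (Finset.subset_univ _) fun α _ _ => decisionWeight_nonneg M p hp α
    _ = 1 := sum_decisionWeight M p hp

/-- The network is stable if every station, with all its competitors busy, can serve its share of
the traffic. -/
theorem stable_of_station_rates {M : ℕ} [NeZero M] {p : ℝ≥0} (hp : p ≤ 1)
    {redLaw greenLaw : PMF ℕ} {lR lG : ℝ} (hR : HasMean redLaw lR) (hG : HasMean greenLaw lG)
    (hp0 : 0 < p) (hred : lR < 1 - (p : ℝ))
    (hgreen : lG < (M - lR / (1 - (p : ℝ))) * (p * (1 - (p : ℝ)) ^ (M - 1))) :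
    Stable M p hp redLaw greenLaw := by
  have hM : (0 : ℝ) < M := by exact_mod_cast Nat.pos_of_ne_zero (NeZero.ne M)
  have hlR := hR.nonneg
  have hp0' : (0 : ℝ) < p := hp0
  have hq : (0 : ℝ) < 1 - p := by linarith
  obtain ⟨c, hc⟩ : ∃ c : ℝ, c = p * (1 - p) ^ (M - 1) := ⟨_, rfl⟩
  have hc0 : 0 < c := hc ▸ by positivity
  rw [← hc] at hgreen
  have hR0 : redLaw 0 ≠ 0 := hR.apply_zero_ne_zero (by linarith)
  have hG0 : greenLaw 0 ≠ 0 := by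
    refine hG.apply_zero_ne_zero (hgreen.trans_le ?_)
    have h1 := card_mul_decisionWeight_single_le_one M hp
    rw [← hc] at h1
    have h2 : 0 ≤ lR / (1 - p) * c := by positivity
    linarith
  have hreach := reaches_empty (M := M) (hp := hp) hp0 (by exact_mod_cast sub_pos.1 hq) hR0 hG0
  refine ⟨⟨⟨0, 0, 0⟩, fun x => (accessible_iff_reaches _ _ _).2 (hreach x)⟩, fun z hz => ?_⟩
  -- A red message needs about `1 / (1 - p)` attempts, each worth `c` of green service: this is its
  -- price `κ`.
  obtain ⟨κ, hκ⟩ : ∃ κ, κ = c / (1 - p) := ⟨_, rfl⟩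
  obtain ⟨θ, hθ⟩ : ∃ θ : ℝ, θ = (1 - p) / M := ⟨_, rfl⟩
  obtain ⟨η, hη⟩ : ∃ η, η = θ - lR / M := ⟨_, rfl⟩
  obtain ⟨ε, hε⟩ : ∃ ε, ε = c - (lG / M + κ * (lR / M)) := ⟨_, rfl⟩
  obtain ⟨γ, hγ⟩ : ∃ γ, γ = (c * κ + ε) / η + 1 := ⟨_, rfl⟩
  have hκ0 : 0 ≤ κ := by rw [hκ]; positivity
  have hθ0 : 0 ≤ θ := by rw [hθ]; positivity
  have hη0 : 0 < η := by
    rw [hη, hθ, ← sub_div]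
    exact div_pos (by linarith) hM
  have hε0 : 0 < ε := by
    have : ε = ((M - lR / (1 - p)) * c - lG) / M := by
      rw [hε, hκ]
      field_simp
      ring
    rw [this]
    exact div_pos (by linarith) hM
  have hγ1 : 1 ≤ γ := by
    rw [hγ]
    have : 0 ≤ (c * κ + ε) / η := by positivity
    linarith
  have hγη : c * κ + ε ≤ η * γ := by
    have : η * γ = c * κ + ε + η := by rw [hγ]; field_simp
    linarith
  have hk : 0 < 1 + κ + γ := by linarith
  -- Large batches may use up a quarter of the drift `ε`.
  obtain ⟨δ, hδ⟩ : ∃ δ, δ = ε / (4 * (1 + κ + γ)) := ⟨_, rfl⟩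
  have hδ0 : 0 < δ := by rw [hδ]; positivity
  have hδε : (1 + κ + γ) * δ = ε / 4 := by rw [hδ]; field_simp
  obtain ⟨K₁, hK₁⟩ := hR.exists_pmfMean_excess_le (ENNReal.ofReal_pos.2 hδ0)
  obtain ⟨K₂, hK₂⟩ := hG.exists_pmfMean_excess_le (ENNReal.ofReal_pos.2 hδ0)
  set K := max K₁ K₂
  have hC0 : 0 ≤ curvature M κ γ θ K := by unfold curvature; positivity
  set C := curvature M κ γ θ K
  have hdrift (s : State M) : pmfMean (transition M p hp redLaw greenLaw s)
      (fun t => ENNReal.ofReal (smoothNorm (load κ γ θ t)))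
      ≤ ENNReal.ofReal (smoothNorm (load κ γ θ s) - 3 / 4 * ε
        + (C + ε) / smoothNorm (load κ γ θ s)) := by
    refine (pmfMean_smoothNorm_load_le hp hR hG hκ0 (by linarith) hθ0 hδ0.le
      (hK₁ K (le_max_left _ _)) (hK₂ K (le_max_right _ _)) s).trans (ENNReal.ofReal_le_ofReal ?_)
    have hn := smoothNorm_pos (load κ γ θ s)
    have h1 := Finset.sum_le_sum fun i (_ : i ∈ Finset.univ) =>
      station_drift_le (g := lG / M) (a := lR / M) (ε := ε) (η := η) hp hc
        (by rw [hκ]; field_simp) hκ0 (by rw [hε]; ring) (by rw [hθ]; field_simp)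
        (by rw [hη]; ring) hθ0 hγ1 hγη s i
    have h2 := smoothNorm_le_one_add_sum (load_nonneg hκ0 (by linarith : 0 ≤ γ) hθ0 s)
    rw [Fintype.sum_sum_type, ← Finset.sum_add_distrib] at h2
    rw [← Finset.mul_sum] at h1
    have h3 := mul_le_mul_of_nonneg_left h2 hε0.le
    have h4 := div_le_div_of_nonneg_right (add_le_add_left (h1.trans (by linarith :
      _ ≤ ε - ε * smoothNorm (load κ γ θ s))) C) hn.le
    have h5 : (ε - ε * smoothNorm (load κ γ θ s) + C) / smoothNorm (load κ γ θ s)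
        = (C + ε) / smoothNorm (load κ γ θ s) - ε := by
      field_simp
      ring
    rw [h5] at h4
    rw [hδε]
    linarith
  refine isPositiveRecurrentSet_singleton_of_drift _
    (f := fun t => ENNReal.ofReal (smoothNorm (load κ γ θ t)))
    (ε := ENNReal.ofReal (ε / 4)) (b := ENNReal.ofReal (C + ε))
    (fun _ => ENNReal.ofReal_ne_top)
    (finite_setOf_smoothNorm_load_lt hκ0 hγ1 hθ0 (2 * (C + ε) / ε))
    (ENNReal.ofReal_pos.2 (by positivity)).ne' ENNReal.ofReal_ne_top ENNReal.ofReal_ne_top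
    (fun s => ?_) hz
  have hn1 := one_le_smoothNorm (load κ γ θ s)
  have hn := smoothNorm_pos (load κ γ θ s)
  have hfrac : (C + ε) / smoothNorm (load κ γ θ s) ≤ C + ε := div_le_self (by linarith) hn1
  -- The bound dominates the mean of a function which is at least `1`.
  have hpos : 0 ≤ smoothNorm (load κ γ θ s) - 3 / 4 * ε
      + (C + ε) / smoothNorm (load κ γ θ s) := by
    have h1 : (1 : ℝ≥0∞) ≤ pmfMean (transition M p hp redLaw greenLaw s)
        (fun t => ENNReal.ofReal (smoothNorm (load κ γ θ t))) := by
      rw [← pmfMean_const (transition M p hp redLaw greenLaw s) 1]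
      exact pmfMean_mono _ fun t => ENNReal.one_le_ofReal.2 (one_le_smoothNorm _)
    exact zero_le_one.trans (ENNReal.one_le_ofReal.1 (h1.trans (hdrift s)))
  refine (add_le_add (hdrift s) le_rfl).trans ?_
  rw [← ENNReal.ofReal_add hpos (by positivity)]
  by_cases hs : s ∈ {s : State M | smoothNorm (load κ γ θ s) < 2 * (C + ε) / ε}
  · rw [Set.indicator_of_mem hs,
      ← ENNReal.ofReal_add hn.le (by positivity)]
    exact ENNReal.ofReal_le_ofReal (by linarith)
  · rw [Set.indicator_of_notMem hs, add_zero]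
    refine ENNReal.ofReal_le_ofReal ?_
    -- The threshold `2(C + ε)/ε` is chosen for this: a drift of `-3ε/4 + ε/2 = -ε/4` remains.
    have h1 : (C + ε) / smoothNorm (load κ γ θ s) ≤ ε / 2 := by
      rw [Set.mem_ofPred_eq, not_lt, div_le_iff₀ hε0] at hs
      rw [div_le_iff₀ hn]
      linarith
    linarith

end MultiAccess

theorem theorem4 (M : ℕ) [NeZero M] (p : ℝ≥0) (hp : p ≤ 1) (redLaw greenLaw : PMF ℕ)
    (lR lG : ℝ) (hR : MultiAccess.HasMean redLaw lR) (hG : MultiAccess.HasMean greenLaw lG)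
    (hred : lR < 1 - (p : ℝ))
    (hgreen_one : M = 1 → lG < (1 - lR / (1 - (p : ℝ))) * p)
    (hgreen : 1 < M → lG < lR / (1 - (p : ℝ)) * ((M : ℝ) - 1) * p * (1 - (p : ℝ)) ^ (M - 1)
      + (1 - lR / (1 - (p : ℝ))) * M * p * (1 - (p : ℝ)) ^ (M - 1)) :
    MultiAccess.Stable M p hp redLaw greenLaw := by
  -- Both cases are one condition, as `ρ(M - 1) + (1 - ρ)M = M - ρ`.
  have hrate : lG < (M - lR / (1 - (p : ℝ))) * (p * (1 - (p : ℝ)) ^ (M - 1)) := by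
    rcases (Nat.one_le_iff_ne_zero.2 (NeZero.ne M)).eq_or_lt with h | h
    · obtain rfl : M = 1 := h.symm
      simpa using hgreen_one rfl
    · refine (hgreen h).trans_eq ?_
      ring
  have hp0 : 0 < p := by
    refine pos_iff_ne_zero.2 fun h => ?_
    have := hG.nonneg
    simp only [h, NNReal.coe_zero, zero_mul, mul_zero] at hrate
    linarith
  exact MultiAccess.stable_of_station_rates hp hR hG hp0 hred hrate
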